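/- For $k,x\in\{0,1\}^c$ let $\mathsf{Par}_k(x)=\bigoplus_{j} k_jx_j$; for $t,y\in\{0,1\}^b$, read as integers in $\{0,\dots,2^b-1\}$, let $\mathsf{Thr}_t(y)=1$ if $y\ge t$ and $0$ otherwise. Let $\mathsf{ParityThresh}_{b,c}$ be the class of all functions $(x,y)\mapsto \mathsf{Par}_k(x)\oplus\mathsf{Thr}_t(y)$ on $\{0,1\}^c\times\{0,1\}^b$ with $k\in\{0,1\}^c$, $t\in\{0,1\}^b$. We consider protocols between a referee without input and parties that each hold some labeled examples, have private random coins and communicate only with the referee, by messages that are finite strings. In each round the referee sends a message to every party and every party replies; after the last round the referee outputs a hypothesis. In the $(m,n)$-hybrid model the parties are a curator holding $m$ examples and $n$ local agents holding one example each; in the local model with $N$ agents there are $N$ parties holding one example each; in the curator model with $M$ samples there is a single party, holding $M$ examples. A protocol is non-interactive if there is one round, in which the referee sends nothing and all parties simultaneously send one message. It is $\varepsilon$-differentially private if for every party $P$, every randomized adversary $A$ that interacts with $P$ in place of everybody else (sending arbitrary messages), all inputs $\mathbf x,\mathbf x'$ of $P$ that differ in at most one example, and every measurable event $T$, the output of $A$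 satisfies $\Pr[A_P(\mathbf x)\in T]\le e^{\varepsilon}\Pr[A_P(\mathbf x')\in T]$. It is an $(\alpha,\beta)$-PAC learner for a class $\mathcal C$ of functions $X\to\{0,1\}$ if for every $f\in\mathcal C$ and every probability distribution $\mathcal D$ on $X$, when all examples are drawn i.i.d. from $\mathcal D$ and labeled by $f$, the output $h$ satisfies $\Pr_{x\sim\mathcal D}[h(x)\ne f(x)]\le\alpha$ with probability at least $1-\beta$. For $c\ge 1$ call a protocol a private learner if it is $\frac14$-differentially private and a $(\frac14,\frac14)$-PAC learner for $\mathsf{ParityThresh}_{b,c}$ with $b=c^2$. **Theorem.** There are functions $m=m(c)=\Theta(c)$ and $n=n(c)=\Theta(c^6\log c)$ such that, as $c\to\infty$ where asymptotic notation is used: 1. For every $c\ge1$ there is a non-interactive private learner in the $(m,n)$-hybrid model. 2. Every private learner in the local model with $o\bigl(2^{(n/\log n)^{1/6}}\bigr)$ agents uses $2^{\Omega((n/\log n)^{1/6})}$ rounds. That is, there is $\kappa>0$ such that for all $N=N(c)=o\bigl(2^{(n/\log n)^{1/6}}\bigr)$ and all sufficiently large $c$, every private learner in the local model with $N$ agents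 has at least $2^{\kappa (n/\log n)^{1/6}}$ rounds. 3. Every private learner in the curator model needs $\Omega(m^2)$ samples. That is, there is $\kappa>0$ such that for all sufficiently large $c$, every private learner in the curator model uses at least $\kappa m^2$ samples. -/

import Mathlib

open MeasureTheory Filter Asymptotics

/-! ## Interactive protocols between a referee and input-holding parties -/

/-- Messages are finite strings, coded as natural numbers; `0` codes the empty string. -/
abbrev Msg : Type := ℕ

/-- An interactive randomized functionality that holds `ℓ` data points from `Z`. Its next message
is a function of its input, its private random coins and the messages it has received so far
(most recent one first). The coins come from an arbitrary probability space. -/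
structure Party (ℓ : ℕ) (Z : Type) : Type 1 where
  Coins : Type
  [space : MeasurableSpace Coins]
  law : Measure Coins
  [isProb : IsProbabilityMeasure law]
  next : (Fin ℓ → Z) → Coins → List Msg → Msg
  measurable_next : ∀ x received, Measurable fun ω => next x ω received

attribute [instance] Party.space Party.isProb

/-- A protocol between parties indexed by `ι`, where party `i` holds `ℓ i` data points, and a
referee without input. The parties communicate only with the referee. In each round the referee
sends a message to every party (a function of its coins and of all replies of the earlier rounds,
most recent round first), and then every party replies. After the last round the referee writes
an output in `O`. A string of shared randomness can be part of the first messages of the referee. -/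
structure Protocol (ι : Type) (ℓ : ι → ℕ) (Z O : Type) [MeasurableSpace O] : Type 1 where
  rounds : ℕ
  party : (i : ι) → Party (ℓ i) Z
  RefCoins : Type
  [refSpace : MeasurableSpace RefCoins]
  refLaw : Measure RefCoins
  [refIsProb : IsProbabilityMeasure refLaw]
  query : RefCoins → List (ι → Msg) → ι → Msg
  measurable_query : ∀ replies i, Measurable fun ρ => query ρ replies i
  output : RefCoins → List (ι → Msg) → O
  measurable_output : ∀ replies, Measurable fun ρ => output ρ replies

attribute [instance] Protocol.refSpace Protocol.refIsProb

namespace Protocol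

variable {ι : Type} {ℓ : ι → ℕ} {Z O : Type} [MeasurableSpace O]

/-- The state of an execution after a number of rounds: for every party the messages it has
received, and the replies that the referee has received (most recent ones first). -/
def run (P : Protocol ι ℓ Z O) (x : (i : ι) → Fin (ℓ i) → Z)
    (ω : (i : ι) → (P.party i).Coins) (ρ : P.RefCoins) :
    ℕ → (ι → List Msg) × List (ι → Msg)
  | 0 => (fun _ => [], [])
  | t + 1 =>
    let s := P.run x ω ρ t
    let received : ι → List Msg := fun i => P.query ρ s.2 i :: s.1 i
    (received, (fun i => (P.party i).next (x i) (ω i) (received i)) :: s.2)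

/-- The output of the referee on the given joint input and coins. -/
def outcome (P : Protocol ι ℓ Z O) (x : (i : ι) → Fin (ℓ i) → Z)
    (ω : (i : ι) → (P.party i).Coins) (ρ : P.RefCoins) : O :=
  P.output ρ (P.run x ω ρ P.rounds).2

/-- All parties simultaneously send a single message to the referee, who sends nothing. -/
def NonInteractive (P : Protocol ι ℓ Z O) : Prop :=
  P.rounds = 1 ∧ ∀ ρ i, P.query ρ [] i = 0

end Protocol

/-! ## Differential privacy against malicious adversaries -/

/-- An adversary, that is, an interactive randomized functionality that controls everybody except
one party. It sees the replies of that party (most recent one first), sends it arbitrary messages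
and finally produces an output. -/
structure Adversary : Type 1 where
  Coins : Type
  [space : MeasurableSpace Coins]
  law : Measure Coins
  [isProb : IsProbabilityMeasure law]
  query : Coins → List Msg → Msg
  measurable_query : ∀ replies, Measurable fun a => query a replies
  Out : Type
  [outSpace : MeasurableSpace Out]
  output : Coins → List Msg → Out
  measurable_output : ∀ replies, Measurable fun a => output a replies

attribute [instance] Adversary.space Adversary.isProb Adversary.outSpace

/-- The state of the interaction of the party `p` with the adversary `A` after a number of rounds:
the messages received by `p` and the replies of `p` (most recent ones first). -/
def Party.interact {ℓ : ℕ} {Z : Type} (p : Party ℓ Z) (A : Adversary) (x : Fin ℓ → Z)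
    (ω : p.Coins) (a : A.Coins) : ℕ → List Msg × List Msg
  | 0 => ([], [])
  | t + 1 =>
    let s := p.interact A x ω a t
    let received := A.query a s.2 :: s.1
    (received, p.next x ω received :: s.2)

/-- The probability that the output of the adversary `A` lies in `T` after it has interacted for
`r` rounds with the party `p` on input `x`. -/
noncomputable def Party.advProb {ℓ : ℕ} {Z : Type} (p : Party ℓ Z) (r : ℕ) (A : Adversary)
    (x : Fin ℓ → Z) (T : Set A.Out) : ℝ :=
  (p.law.prod A.law).real {s | A.output s.2 (p.interact A x s.1 s.2 r).2 ∈ T}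

/-- Two databases are neighboring if they differ on at most one entry. -/
def Neighboring {ℓ : ℕ} {Z : Type} (x x' : Fin ℓ → Z) : Prop :=
  ∃ i, ∀ j, j ≠ i → x j = x' j

/-- `(ε, δ)`-differential privacy of a protocol. The relation `Neighboring` is symmetric, so both
inequalities in the definition of `(ε, δ)`-closeness are covered. -/
def Protocol.IsApproxDP {ι : Type} {ℓ : ι → ℕ} {Z O : Type} [MeasurableSpace O]
    (P : Protocol ι ℓ Z O) (ε δ : ℝ) : Prop :=
  ∀ (i : ι) (A : Adversary) (x x' : Fin (ℓ i) → Z), Neighboring x x' →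
    ∀ T : Set A.Out, MeasurableSet T →
      (P.party i).advProb P.rounds A x T
        ≤ Real.exp ε * (P.party i).advProb P.rounds A x' T + δ

/-- Pure `ε`-differential privacy. -/
def Protocol.IsDP {ι : Type} {ℓ : ι → ℕ} {Z O : Type} [MeasurableSpace O]
    (P : Protocol ι ℓ Z O) (ε : ℝ) : Prop :=
  P.IsApproxDP ε 0

/-! ## PAC learning -/

/-- The generalization error of the hypothesis `h` with respect to the concept `f` and the
distribution `D`. -/
noncomputable def genError {X : Type} [MeasurableSpace X] (D : Measure X) (f h : X → Bool) : ℝ :=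
  D.real {x | h x ≠ f x}

/-- The protocol `P` is an `(α, β)`-PAC learner for the concept class `C`: for every `f ∈ C` and
every distribution `D`, when all the data points are drawn independently from `D` and labeled by
`f`, the output has error at most `α` with probability at least `1 - β`. -/
def Protocol.IsPACLearner {ι : Type} [Fintype ι] {ℓ : ι → ℕ} {X : Type} [MeasurableSpace X]
    (P : Protocol ι ℓ (X × Bool) (X → Bool)) (C : Set (X → Bool)) (α β : ℝ) : Prop :=
  ∀ f ∈ C, ∀ D : Measure X, IsProbabilityMeasure D →
    1 - β ≤
      ((Measure.pi fun i : ι => Measure.pi fun _ : Fin (ℓ i) => D).prod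
        ((Measure.pi fun i : ι => (P.party i).law).prod P.refLaw)).real
        {s | genError D f
          (P.outcome (fun i j => (s.1 i j, f (s.1 i j))) s.2.1 s.2.2) ≤ α}

/-! ## The curator model, the local model and the hybrid model -/

/-- Protocols in the curator model with `m` samples: a single party that holds all the data. -/
abbrev CuratorProtocol (m : ℕ) (Z O : Type) [MeasurableSpace O] : Type 1 :=
  Protocol Unit (fun _ => m) Z O

/-- Protocols in the local model with `n` agents, each of which holds a single data point. -/
abbrev LocalProtocol (n : ℕ) (Z O : Type) [MeasurableSpace O] : Type 1 :=
  Protocol (Fin n) (fun _ => 1) Z O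

/-- The number of data points of each party in the `(m, n)`-hybrid model; `none` is the curator. -/
def hybridSize (m n : ℕ) : Option (Fin n) → ℕ
  | none => m
  | some _ => 1

/-- Protocols in the `(m, n)`-hybrid model: a curator with `m` data points and `n` local agents
with one data point each. -/
abbrev HybridProtocol (m n : ℕ) (Z O : Type) [MeasurableSpace O] : Type 1 :=
  Protocol (Option (Fin n)) (hybridSize m n) Z O

/-! ## Parity XOR threshold -/

/-- The strings `{0,1}^c`. -/
abbrev Bits (c : ℕ) : Type := Fin c → Bool

/-- `Par_k(x) = ⊕ j, k_j x_j`. -/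
def par {c : ℕ} (k x : Bits c) : Bool :=
  decide (Odd (Finset.univ.filter fun j => k j = true ∧ x j = true).card)

/-- The integer in `{0, …, 2^b - 1}` that a string represents in binary (most significant bit
first). -/
def Bits.val {b : ℕ} (y : Bits b) : ℕ :=
  ∑ i : Fin b, if y i = true then 2 ^ (Fin.rev i : ℕ) else 0

/-- `Thr_t(y) = 1` if and only if `y ≥ t`. -/
def thr {b : ℕ} (t y : Bits b) : Bool :=
  decide (t.val ≤ y.val)

/-- The concept class of all functions `(x, y) ↦ Par_k(x) ⊕ Thr_t(y)`. -/
def ParityThresh (b c : ℕ) : Set (Bits c × Bits b → Bool) :=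
  {f | ∃ (k : Bits c) (t : Bits b), f = fun z => xor (par k z.1) (thr t z.2)}

/-- A `1/4`-differentially private `(1/4, 1/4)`-PAC learner for `ParityThresh b c`. -/
def Protocol.IsPrivateLearner {ι : Type} [Fintype ι] {ℓ : ι → ℕ} {b c : ℕ}
    (P : Protocol ι ℓ ((Bits c × Bits b) × Bool) (Bits c × Bits b → Bool)) : Prop :=
  P.IsDP (1 / 4) ∧ P.IsPACLearner (ParityThresh b c) (1 / 4) (1 / 4)

/-- The exponent `(n / log n)^(1/6)`, with the logarithm to base `2`. -/
noncomputable def localExponent (n : ℕ) : ℝ :=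
  ((n : ℝ) / Real.logb 2 n) ^ (1 / 6 : ℝ)

/-!
Lower bound in the curator model: attach to each threshold the uniform distribution on the points at
which binary search for it branches. The errors of a hypothesis on these points determine the
threshold, so that few thresholds share a good hypothesis. By group privacy the output on `M`
samples depends on the threshold only up to a factor `exp (ε * M)`, so that `M` is at least linear
in `b`.

Lower bound in the local model: with the threshold `0`, the uniform distribution and a random parity
as the target, a single message of an agent carries little information on the parity on average, by
Parseval's identity. Summed over the agents, however the rounds interleave, the transcript stays
close to the transcript for random labels unless the number of agents is exponential in `c`.

The hybrid learner: the curator selects a parity together with a quantile instead of a threshold, by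
the exponential mechanism. The number of pairs is `2 ^ O(c)`, and replacing thresholds by quantiles
costs little by a bracketing argument. The agents do not know the parity, but the distribution of
the thresholds does not depend on the labels: with randomized response each agent reports one bit of
its position relative to all thresholds, on a random level of the binary tree. This gives the
referee estimates of all quantiles, and a threshold for the selected quantile.
-/

open scoped Finset

/-! ## Binary strings and thresholds -/

namespace Bits

variable {b : ℕ}

lemma val_succ (y : Bits (b + 1)) :
    y.val = (if y 0 = true then 2 ^ b else 0) + val (b := b) (fun i => y i.succ) := by
  simp [val, Fin.sum_univ_succ]

lemma val_lt_two_pow (y : Bits b) : y.val < 2 ^ b := by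
  induction b with
  | zero => simp [val]
  | succ b ih =>
    have := ih fun i => y i.succ
    rw [val_succ, pow_succ]
    split_ifs <;> omega

lemma val_lt_val_iff_lex (y t : Bits b) :
    y.val < t.val ↔ ∃ j, t j = true ∧ y j = false ∧ ∀ i < j, y i = t i := by
  induction b with
  | zero => simp [val]
  | succ b ih =>
    have hy_lt := val_lt_two_pow fun i => y i.succ
    have ht_lt := val_lt_two_pow fun i => t i.succ
    have tail_iff : (∃ i : Fin b, t i.succ = true ∧ y i.succ = false ∧
        ∀ i' < i.succ, y i' = t i') ↔
        y 0 = t 0 ∧ val (fun i => y i.succ) < val fun i => t i.succ := by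
      simp only [ih, Fin.forall_fin_succ, Fin.succ_pos, Fin.succ_lt_succ_iff, forall_true_left]
      tauto
    rw [val_succ, val_succ, Fin.exists_fin_succ, tail_iff]
    cases hy : y 0 <;> cases ht : t 0 <;> simp <;> omega

end Bits

/-- The point at which the binary search for the threshold `t` branches at level `j`: it agrees
with `t` before `j` and continues with `0111…`. -/
def branchPoint {b : ℕ} (t : Bits b) (j : Fin b) : Bits b := fun i =>
  if i < j then t i else decide (j < i)

lemma thr_branchPoint {b : ℕ} (t : Bits b) (j : Fin b) : thr t (branchPoint t j) = !t j := by
  have h : (branchPoint t j).val < t.val ↔ t j = true := by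
    rw [Bits.val_lt_val_iff_lex]
    constructor
    · rintro ⟨i, hti, hbi, -⟩
      rcases lt_trichotomy i j with hij | rfl | hij
      · simp [branchPoint, hij, hti] at hbi
      · exact hti
      · simp [branchPoint, hij, hij.le.not_gt] at hbi
    · intro hj
      exact ⟨j, hj, by simp [branchPoint], fun i hi => by simp [branchPoint, hi]⟩
  cases hj : t j <;> simpa [thr, hj] using h

lemma branchPoint_congr {b : ℕ} {t t' : Bits b} {j : Fin b} (h : ∀ i < j, t i = t' i) :
    branchPoint t j = branchPoint t' j := by
  funext i
  exact ite_congr rfl (h i) fun _ => rfl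

/-- The error pattern of the hypothesis `h` on the branch points of `t`. -/
def branchErrors {b : ℕ} (h : Bits b → Bool) (t : Bits b) : Bits b := fun j =>
  decide (h (branchPoint t j) ≠ thr t (branchPoint t j))

-- The error at level `j` reveals `t j` once the earlier bits, hence the branch point, are known.
lemma branchErrors_bijective {b : ℕ} (h : Bits b → Bool) :
    Function.Bijective (branchErrors h) := by
  refine Finite.injective_iff_bijective.1 fun t t' htt => funext fun j => ?_
  induction j using WellFoundedLT.induction with
  | ind j ih =>
    have hj := congrFun htt j
    rw [branchErrors, branchErrors, thr_branchPoint, thr_branchPoint, branchPoint_congr ih] at hj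
    revert hj
    cases t j <;> cases t' j <;> cases h (branchPoint t' j) <;> simp

lemma sum_pow_card_true (b : ℕ) (s : ℝ) :
    ∑ d : Bits b, s ^ #{j | d j = true} = (1 + s) ^ b := by
  calc ∑ d : Bits b, s ^ #{j | d j = true} = ∑ d : Bits b, ∏ j, if d j = true then s else 1 := by
        simp only [Finset.prod_ite, Finset.prod_const, one_pow, mul_one]
    _ = (1 + s) ^ b := by
        rw [← Fintype.prod_sum fun (_ : Fin b) (a : Bool) => if a = true then s else 1]
        simp [add_comm]

lemma card_branchErrors_le {b : ℕ} (h : Bits b → Bool) (α : ℝ) :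
    (#{t : Bits b | (#{j | branchErrors h t j = true} : ℝ) ≤ α * b} : ℝ)
      ≤ (3 / 2) ^ b * 2 ^ (α * b) := by
  have generating_function :
      ∑ t : Bits b, (1 / 2 : ℝ) ^ #{j | branchErrors h t j = true} = (3 / 2) ^ b := by
    rw [(branchErrors_bijective h).sum_comp fun d : Bits b => (1 / 2 : ℝ) ^ #{j | d j = true},
      sum_pow_card_true]
    norm_num
  rw [← generating_function, Finset.sum_mul, Finset.natCast_card_filter]
  refine Finset.sum_le_sum fun t _ => ?_
  split_ifs with ht
  · rw [one_div, inv_pow, ← Real.rpow_natCast, ← Real.rpow_neg (by norm_num),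
      ← Real.rpow_add (by norm_num)]
    exact Real.one_le_rpow (by norm_num) (by linarith)
  · positivity

/-! ## Fourier analysis of parities -/

/-- The `±1`-encoding `(-1)^a` of a bit `a`. -/
def sgn (a : Bool) : ℝ := if a = true then -1 else 1

lemma sgn_mul_self (a : Bool) : sgn a * sgn a = 1 := by cases a <;> simp [sgn]

lemma abs_sgn (a : Bool) : |sgn a| = 1 := by cases a <;> simp [sgn]

lemma sgn_not (a : Bool) : sgn (!a) = -sgn a := by cases a <;> simp [sgn]

section Fourier

variable {c : ℕ}

lemma sgn_par (k x : Bits c) :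
    sgn (par k x) = ∏ j, if k j = true ∧ x j = true then (-1 : ℝ) else 1 := by
  rw [Finset.prod_ite, Finset.prod_const_one, mul_one, Finset.prod_const]
  by_cases h : Odd #{j | k j = true ∧ x j = true}
  · simp [sgn, par, h, h.neg_one_pow]
  · simp [sgn, par, h, (Nat.not_odd_iff_even.1 h).neg_one_pow]

lemma sum_sgn_par_mul_sgn_par (x x' : Bits c) :
    ∑ k, sgn (par k x) * sgn (par k x') = if x = x' then (2 : ℝ) ^ c else 0 := by
  simp_rw [sgn_par, ← Finset.prod_mul_distrib]
  rw [← Fintype.prod_sum fun (j : Fin c) (a : Bool) =>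
    (if a = true ∧ x j = true then (-1 : ℝ) else 1) * if a = true ∧ x' j = true then -1 else 1]
  have coordinate_sum (j : Fin c) :
      ∑ a : Bool, (if a = true ∧ x j = true then (-1 : ℝ) else 1) *
        (if a = true ∧ x' j = true then -1 else 1) = if x j = x' j then 2 else 0 := by
    cases x j <;> cases x' j <;> norm_num
  simp_rw [coordinate_sum]
  split_ifs with hx
  · simp [hx]
  · obtain ⟨j, hj⟩ := Function.ne_iff.1 hx
    exact Finset.prod_eq_zero (Finset.mem_univ j) (if_neg hj)

/-- The (unnormalized) Fourier coefficient of `v` at the parity `k`. -/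
def parityCoeff (v : Bits c → ℝ) (k : Bits c) : ℝ := ∑ x, v x * sgn (par k x)

lemma sum_sq_parityCoeff (v : Bits c → ℝ) :
    ∑ k, parityCoeff v k ^ 2 = 2 ^ c * ∑ x, v x ^ 2 := by
  calc ∑ k, parityCoeff v k ^ 2
      = ∑ k, ∑ x, ∑ x', v x * v x' * (sgn (par k x) * sgn (par k x')) := by
        refine Finset.sum_congr rfl fun k _ => ?_
        rw [parityCoeff, sq, Finset.sum_mul_sum]
        exact Finset.sum_congr rfl fun x _ => Finset.sum_congr rfl fun x' _ => by ring
    _ = ∑ x, ∑ x', v x * v x' * ∑ k, sgn (par k x) * sgn (par k x') := by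
        simp_rw [Finset.mul_sum]
        rw [Finset.sum_comm]
        exact Finset.sum_congr rfl fun x _ => Finset.sum_comm
    _ = 2 ^ c * ∑ x, v x ^ 2 := by
        simp only [sum_sgn_par_mul_sgn_par, mul_ite, mul_zero, Finset.sum_ite_eq, Finset.mem_univ,
          if_true, Finset.mul_sum]
        exact Finset.sum_congr rfl fun x _ => by ring

lemma sum_abs_parityCoeff_le {v : Bits c → ℝ} {B : ℝ} (hB : 0 ≤ B) (hv : ∀ x, |v x| ≤ B) :
    ∑ k, |parityCoeff v k| ≤ 2 ^ c * √(2 ^ c) * B := by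
  refine le_of_sq_le_sq ?_ (by positivity)
  calc (∑ k, |parityCoeff v k|) ^ 2 ≤ 2 ^ c * ∑ k, parityCoeff v k ^ 2 := by
        simpa [sq_abs] using sq_sum_le_card_mul_sum_sq (s := Finset.univ)
          (f := fun k => |parityCoeff v k|)
    _ ≤ 2 ^ c * (2 ^ c * ∑ _x : Bits c, B ^ 2) := by
        rw [sum_sq_parityCoeff]
        gcongr 2 ^ c * (2 ^ c * ∑ _, ?_) with x
        exact sq_le_sq.2 ((hv x).trans (le_abs_self B))
    _ = (2 ^ c * √(2 ^ c) * B) ^ 2 := by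
        rw [mul_pow, mul_pow, Real.sq_sqrt (by positivity)]
        simp only [Finset.sum_const, Finset.card_univ, Fintype.card_pi, Fintype.card_bool,
          Finset.prod_const, Fintype.card_fin, nsmul_eq_mul, Nat.cast_pow, Nat.cast_ofNat]
        ring

lemma parityCoeff_sgn_not (h : Bits c → Bool) (k : Bits c) :
    parityCoeff (fun x => sgn (!h x)) k = 2 ^ c - 2 * #{x | h x ≠ !par k x} := by
  have h_card : (2 : ℝ) ^ c = ∑ _x : Bits c, (1 : ℝ) := by simp
  rw [parityCoeff, h_card, Finset.natCast_card_filter, Finset.mul_sum, ← Finset.sum_sub_distrib]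
  refine Finset.sum_congr rfl fun x _ => ?_
  cases h x <;> cases par k x <;> norm_num [sgn]

-- Every parity `k` close to `h` takes a constant share of the total Fourier weight.
lemma card_parities_close_le (h : Bits c → Bool) {α : ℝ} (hα : α ≤ 1 / 2) :
    #{k : Bits c | (#{x | h x ≠ !par k x} : ℝ) / 2 ^ c ≤ α} * (1 - 2 * α) ^ 2 ≤ 1 := by
  set G : Finset (Bits c) := {k | (#{x | h x ≠ !par k x} : ℝ) / 2 ^ c ≤ α}
  let v : Bits c → ℝ := fun x => sgn (!h x)
  have large_coeff : ∀ k ∈ G, (2 ^ c * (1 - 2 * α)) ^ 2 ≤ parityCoeff v k ^ 2 := by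
    intro k hk
    have hk_close := (Finset.mem_filter.1 hk).2
    rw [div_le_iff₀ (by positivity)] at hk_close
    rw [parityCoeff_sgn_not]
    exact pow_le_pow_left₀ (mul_nonneg (by positivity) (by linarith)) (by linarith) 2
  have total_weight : #G * (2 ^ c * (1 - 2 * α)) ^ 2 ≤ (2 ^ c) ^ 2 := by
    calc #G * (2 ^ c * (1 - 2 * α)) ^ 2 = ∑ _k ∈ G, (2 ^ c * (1 - 2 * α)) ^ 2 := by simp
      _ ≤ ∑ k ∈ G, parityCoeff v k ^ 2 := Finset.sum_le_sum large_coeff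
      _ ≤ ∑ k, parityCoeff v k ^ 2 :=
        Finset.sum_le_univ_sum_of_nonneg fun _ => sq_nonneg _
      _ = (2 ^ c) ^ 2 := by
        rw [sum_sq_parityCoeff]
        simp [v, sq, sgn_mul_self]
  have h_pos : (0 : ℝ) < (2 ^ c) ^ 2 := by positivity
  rw [mul_pow, mul_left_comm] at total_weight
  exact (mul_le_iff_le_one_right h_pos).1 total_weight

lemma sum_abs_labeled_mean_sub_mean_le {w : Bits c × Bool → ℝ} {K : ℝ} (hw : ∀ z, 0 ≤ w z)
    (hK : ∀ z z', w z ≤ K * w z') :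
    ∑ k : Bits c, |(∑ x, w (x, !par k x)) / 2 ^ c - (∑ z, w z) / 2 ^ (c + 1)| ≤
      √(2 ^ c) * (K / 2 * ((∑ z, w z) / 2 ^ (c + 1))) := by
  set W := (∑ z, w z) / 2 ^ (c + 1) with hW
  have le_mean (z : Bits c × Bool) : w z ≤ K * W := by
    have h_sum := Finset.card_nsmul_le_sum Finset.univ (fun z' => K * w z') (w z)
      fun z' _ => hK z z'
    rw [← Finset.mul_sum] at h_sum
    rw [hW, ← mul_div_assoc, le_div_iff₀ (by positivity), mul_comm]
    simpa [pow_succ] using h_sum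
  let v : Bits c → ℝ := fun x => (w (x, true) - w (x, false)) / 2
  have abs_v_le (x : Bits c) : |v x| ≤ K * W / 2 := by
    have := le_mean (x, true)
    have := le_mean (x, false)
    have := hw (x, true)
    have := hw (x, false)
    exact abs_le.2 ⟨by simp only [v]; linarith, by simp only [v]; linarith⟩
  have deviation_eq (k : Bits c) :
      (∑ x, w (x, !par k x)) / 2 ^ c - W = parityCoeff v k / 2 ^ c := by
    have h_labeled : ∑ x, w (x, !par k x) = parityCoeff v k + (∑ z, w z) / 2 := by
      rw [parityCoeff, Fintype.sum_prod_type, Finset.sum_div, ← Finset.sum_add_distrib]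
      refine Finset.sum_congr rfl fun x _ => ?_
      cases par k x <;> simp [sgn, v] <;> ring
    rw [h_labeled, hW, pow_succ]
    field_simp
    ring
  simp_rw [deviation_eq, abs_div, abs_of_pos (show (0 : ℝ) < 2 ^ c by positivity)]
  rw [← Finset.sum_div, div_le_iff₀ (by positivity)]
  refine (sum_abs_parityCoeff_le ((abs_nonneg _).trans (abs_v_le fun _ => false)) abs_v_le).trans_eq
    (by ring)

end Fourier

/-! ## Finite measures and measurability -/

section Probability

variable {α β γ : Type*} [MeasurableSpace α] [MeasurableSpace β] [MeasurableSpace γ]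

lemma measurable_apply_of_countable [Countable β] [MeasurableSingletonClass β] {g : α → β → γ}
    {h : α → β} (hg : ∀ b, Measurable fun a => g a b) (hh : Measurable h) :
    Measurable fun a => g a (h a) :=
  (measurable_from_prod_countable_left (f := fun p : α × β => g p.1 p.2) hg).comp
    (measurable_id.prodMk hh)

lemma measureReal_prod_eq_integral (μ : Measure α) (ν : Measure β) [SFinite μ]
    [IsFiniteMeasure ν] {E : Set (α × β)} (hE : MeasurableSet E) :
    (μ.prod ν).real E = ∫ x, ν.real (Prod.mk x ⁻¹' E) ∂μ := by
  simp only [measureReal_def]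
  rw [Measure.prod_apply hE, integral_toReal (measurable_measure_prodMk_left hE).aemeasurable
    (ae_of_all _ fun x => measure_lt_top _ _)]

lemma integrable_measureReal_prodMk_left (μ : Measure α) (ν : Measure β) [IsFiniteMeasure μ]
    [IsFiniteMeasure ν] {E : Set (α × β)} (hE : MeasurableSet E) :
    Integrable (fun x => ν.real (Prod.mk x ⁻¹' E)) μ :=
  Measure.integrable_measure_prodMk_left hE (measure_ne_top _ _)

lemma measureReal_prod_le_of_forall (μ : Measure α) (ν : Measure β) [IsProbabilityMeasure μ]
    [IsFiniteMeasure ν] {E : Set (α × β)} (hE : MeasurableSet E) {C : ℝ}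
    (h : ∀ x, ν.real (Prod.mk x ⁻¹' E) ≤ C) : (μ.prod ν).real E ≤ C := by
  rw [measureReal_prod_eq_integral μ ν hE]
  exact (integral_mono (integrable_measureReal_prodMk_left μ ν hE) (integrable_const C) h).trans_eq
    (by simp)

lemma sum_measureReal_le_of_card_le {κ : Type*} [Fintype κ] (μ : Measure α)
    [IsProbabilityMeasure μ] (E : κ → Set α) (hE : ∀ k, MeasurableSet (E k)) {B : ℝ}
    (hB : ∀ a, ({k | a ∈ E k}.ncard : ℝ) ≤ B) : ∑ k, μ.real (E k) ≤ B := by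
  classical
  have integrable_indicator (k : κ) : Integrable ((E k).indicator (1 : α → ℝ)) μ :=
    (integrable_const 1).indicator (hE k)
  calc ∑ k, μ.real (E k) = ∫ a, ∑ k, (E k).indicator (1 : α → ℝ) a ∂μ := by
        rw [integral_finsetSum _ fun k _ => integrable_indicator k]
        exact Finset.sum_congr rfl fun k _ => (integral_indicator_one (hE k)).symm
    _ ≤ ∫ _, B ∂μ := by
        refine integral_mono (integrable_finsetSum _ fun k _ => integrable_indicator k)
          (integrable_const _) fun a => ?_
        simpa only [Set.indicator_apply, Pi.one_apply, Set.ncard_eq_toFinset_card',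
          Set.toFinset_ofPred, Finset.natCast_card_filter] using hB a
    _ = B := by simp

lemma integral_uniformOn_univ {α : Type*} [Fintype α] [MeasurableSpace α]
    [MeasurableSingletonClass α] (g : α → ℝ) :
    ∫ a, g a ∂(ProbabilityTheory.uniformOn (Set.univ : Set α)) =
      (∑ a, g a) / Fintype.card α := by
  rw [ProbabilityTheory.uniformOn, ProbabilityTheory.cond, Measure.restrict_univ,
    integral_smul_measure, integral_count, Measure.count_apply MeasurableSet.univ]
  simp [Set.encard_univ, div_eq_inv_mul]

end Probability

/-! ## Labeled examples and generalization errors -/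

section GenError

variable {X : Type} [MeasurableSpace X]

lemma genError_map_uniformOn {α : Type*} [Fintype α] [MeasurableSpace α]
    [MeasurableSingletonClass α] [Countable X] [MeasurableSingletonClass X] (g : α → X)
    (f h : X → Bool) :
    genError ((ProbabilityTheory.uniformOn Set.univ).map g) f h =
      (#{a | h (g a) ≠ f (g a)} : ℝ) / Fintype.card α := by
  rw [genError, map_measureReal_apply Measurable.of_discrete
    (Set.to_countable _).measurableSet, measureReal_def, ProbabilityTheory.uniformOn_univ,
    Set.preimage_ofPred_eq, Measure.count_apply (Set.toFinite _).measurableSet,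
    ENNReal.toReal_div]
  simp [Set.encard_eq_coe_toFinset_card]

lemma measurableSet_genError_le [Countable X] [MeasurableSingletonClass X] (D : Measure X)
    [IsFiniteMeasure D] (f : X → Bool) (α : ℝ) : MeasurableSet {h | genError D f h ≤ α} := by
  have h_eval : Measurable fun p : (X → Bool) × X => p.1 p.2 :=
    measurable_from_prod_countable_left fun x => measurable_pi_apply x
  have h_ne : MeasurableSet {p : (X → Bool) × X | p.1 p.2 ≠ f p.2} :=
    (measurableSet_eq_fun h_eval (Measurable.of_discrete.comp measurable_snd)).compl
  exact (measurable_measure_prodMk_left h_ne).ennreal_toReal measurableSet_Iic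

/-- The distribution of a labeled example `(x, f x)` with `x` drawn from `D`. -/
noncomputable def labeledLaw (D : Measure X) (f : X → Bool) : Measure (X × Bool) :=
  D.map fun x => (x, f x)

instance [Countable X] [MeasurableSingletonClass X] (D : Measure X) [IsProbabilityMeasure D]
    (f : X → Bool) : IsProbabilityMeasure (labeledLaw D f) :=
  Measure.isProbabilityMeasure_map Measurable.of_discrete.aemeasurable

end GenError

/-! ## The distribution of the output of a protocol -/

-- Replies of finitely many parties form a countable type, so no finer structure is needed on lists.
instance {α : Type*} : MeasurableSpace (List α) := ⊤

instance {α : Type*} : DiscreteMeasurableSpace (List α) := ⟨fun _ => trivial⟩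

namespace Protocol

variable {ι : Type} {ℓ : ι → ℕ} {Z O : Type} [MeasurableSpace O]

section Measurability

variable [Finite ι] [MeasurableSpace Z] [Countable Z] [MeasurableSingletonClass Z]

lemma measurable_run (P : Protocol ι ℓ Z O) (t : ℕ) :
    Measurable fun s : ((i : ι) → Fin (ℓ i) → Z) × ((i : ι) → (P.party i).Coins) × P.RefCoins =>
      P.run s.1 s.2.1 s.2.2 t := by
  let Ω := ((i : ι) → Fin (ℓ i) → Z) × ((i : ι) → (P.party i).Coins) × P.RefCoins
  have measurable_cons {β : Type} [Countable β] [MeasurableSpace β] [DiscreteMeasurableSpace β]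
      {f : Ω → β} {g : Ω → List β} (hf : Measurable f) (hg : Measurable g) :
      Measurable fun s => f s :: g s :=
    (Measurable.of_discrete (f := fun p : β × List β => p.1 :: p.2)).comp (hf.prodMk hg)
  induction t with
  | zero => exact measurable_const
  | succ t ih =>
    have measurable_query (i : ι) :
        Measurable fun s : Ω => P.query s.2.2 (P.run s.1 s.2.1 s.2.2 t).2 i :=
      measurable_apply_of_countable (g := fun (s : Ω) r => P.query s.2.2 r i)
        (fun r => (P.measurable_query r i).comp measurable_snd.snd) ih.snd
    have measurable_received (i : ι) : Measurable fun s : Ω =>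
        P.query s.2.2 (P.run s.1 s.2.1 s.2.2 t).2 i :: (P.run s.1 s.2.1 s.2.2 t).1 i :=
      measurable_cons (measurable_query i) ((measurable_pi_apply i).comp ih.fst)
    have measurable_reply (i : ι) : Measurable fun s : Ω => (P.party i).next (s.1 i) (s.2.1 i)
        (P.query s.2.2 (P.run s.1 s.2.1 s.2.2 t).2 i :: (P.run s.1 s.2.1 s.2.2 t).1 i) :=
      measurable_apply_of_countable
        (g := fun (s : Ω) (p : (Fin (ℓ i) → Z) × List Msg) => (P.party i).next p.1 (s.2.1 i) p.2)
        (fun p => ((P.party i).measurable_next p.1 p.2).comp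
          ((measurable_pi_apply i).comp measurable_snd.fst))
        (((measurable_pi_apply i).comp measurable_fst).prodMk (measurable_received i))
    exact (measurable_pi_lambda _ measurable_received).prodMk
      (measurable_cons (measurable_pi_lambda _ measurable_reply) ih.snd)

lemma measurable_outcome (P : Protocol ι ℓ Z O) :
    Measurable fun s : ((i : ι) → Fin (ℓ i) → Z) × ((i : ι) → (P.party i).Coins) × P.RefCoins =>
      P.outcome s.1 s.2.1 s.2.2 :=
  measurable_apply_of_countable
    (g := fun (s : ((i : ι) → Fin (ℓ i) → Z) × ((i : ι) → (P.party i).Coins) × P.RefCoins) l =>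
      P.output s.2.2 l)
    (fun l => (P.measurable_output l).comp measurable_snd.snd) (P.measurable_run P.rounds).snd

lemma measurable_outcome_of_data (P : Protocol ι ℓ Z O) (x : (i : ι) → Fin (ℓ i) → Z) :
    Measurable fun s : ((i : ι) → (P.party i).Coins) × P.RefCoins => P.outcome x s.1 s.2 :=
  P.measurable_outcome.comp measurable_prodMk_left

end Measurability

variable [Fintype ι]

/-- The joint distribution of the coins of the parties and of the referee. -/
noncomputable def coinLaw (P : Protocol ι ℓ Z O) :
    Measure (((i : ι) → (P.party i).Coins) × P.RefCoins) :=
  (Measure.pi fun i => (P.party i).law).prod P.refLaw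

instance (P : Protocol ι ℓ Z O) : IsProbabilityMeasure P.coinLaw := by
  unfold coinLaw
  infer_instance

variable [MeasurableSpace Z]

/-- The distribution of the output of the referee when all data points are drawn independently
from `ν`. -/
noncomputable def outputLaw (P : Protocol ι ℓ Z O) (ν : Measure Z) : Measure O :=
  ((Measure.pi fun i => Measure.pi fun _ : Fin (ℓ i) => ν).prod P.coinLaw).map
    fun s => P.outcome s.1 s.2.1 s.2.2

variable [Countable Z] [MeasurableSingletonClass Z]

lemma outputLaw_real_apply (P : Protocol ι ℓ Z O) (ν : Measure Z) {T : Set O}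
    (hT : MeasurableSet T) :
    (P.outputLaw ν).real T =
      ((Measure.pi fun i => Measure.pi fun _ : Fin (ℓ i) => ν).prod P.coinLaw).real
        {s | P.outcome s.1 s.2.1 s.2.2 ∈ T} :=
  map_measureReal_apply P.measurable_outcome hT

lemma outputLaw_real_le_of_forall (P : Protocol ι ℓ Z O) (ν : Measure Z) [IsProbabilityMeasure ν]
    {T : Set O} (hT : MeasurableSet T) {C : ℝ}
    (hC : ∀ x, P.coinLaw.real {s | P.outcome x s.1 s.2 ∈ T} ≤ C) : (P.outputLaw ν).real T ≤ C := by
  rw [P.outputLaw_real_apply ν hT]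
  exact measureReal_prod_le_of_forall _ _ (P.measurable_outcome hT) hC

lemma outputLaw_labeledLaw {X : Type} [MeasurableSpace X] [Countable X]
    [MeasurableSingletonClass X] (P : Protocol ι ℓ (X × Bool) O) (D : Measure X)
    [IsProbabilityMeasure D] (f : X → Bool) {T : Set O} (hT : MeasurableSet T) :
    (P.outputLaw (labeledLaw D f)).real T =
      ((Measure.pi fun i => Measure.pi fun _ : Fin (ℓ i) => D).prod P.coinLaw).real
        {s | P.outcome (fun i j => (s.1 i j, f (s.1 i j))) s.2.1 s.2.2 ∈ T} := by
  have label_preserving : MeasurePreserving (fun x => (x, f x)) D (labeledLaw D f) :=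
    Measurable.of_discrete.measurePreserving D
  have data_preserving := (measurePreserving_pi _ _ fun i : ι =>
    measurePreserving_pi _ _ fun _ : Fin (ℓ i) => label_preserving).prod
      (MeasurePreserving.id P.coinLaw)
  rw [P.outputLaw_real_apply _ hT]
  exact (data_preserving.measureReal_preimage (P.measurable_outcome hT).nullMeasurableSet).symm

lemma IsPACLearner.le_outputLaw {X : Type} [MeasurableSpace X] [Countable X]
    [MeasurableSingletonClass X] {P : Protocol ι ℓ (X × Bool) (X → Bool)} {C : Set (X → Bool)}
    {α β : ℝ} (hP : P.IsPACLearner C α β) {f : X → Bool} (hf : f ∈ C) (D : Measure X)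
    [IsProbabilityMeasure D] :
    1 - β ≤ (P.outputLaw (labeledLaw D f)).real {h | genError D f h ≤ α} := by
  rw [P.outputLaw_labeledLaw D f (measurableSet_genError_le D f α)]
  exact hP f hf D inferInstance

end Protocol

/-! ## A lower bound for the curator model -/

lemma le_exp_mul_of_neighboring {M : ℕ} {Z : Type} {g : (Fin M → Z) → ℝ} {ε : ℝ}
    (hg : ∀ x x', Neighboring x x' → g x ≤ Real.exp ε * g x') (x x' : Fin M → Z) :
    g x ≤ Real.exp (ε * M) * g x' := by
  let hybrid (s : ℕ) : Fin M → Z := fun j => if (j : ℕ) < s then x' j else x j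
  have neighboring_hybrid {s : ℕ} (hs : s < M) : Neighboring (hybrid s) (hybrid (s + 1)) :=
    ⟨⟨s, hs⟩, fun j hj => if_congr (by have := Fin.val_ne_of_ne hj; grind) rfl rfl⟩
  have le_hybrid (s : ℕ) (hs : s ≤ M) : g x ≤ Real.exp (ε * s) * g (hybrid s) := by
    induction s with
    | zero => simp [hybrid]
    | succ s ih =>
      calc g x ≤ Real.exp (ε * s) * g (hybrid s) := ih (by omega)
        _ ≤ Real.exp (ε * s) * (Real.exp ε * g (hybrid (s + 1))) := by
          gcongr
          exact hg _ _ (neighboring_hybrid hs)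
        _ = Real.exp (ε * (s + 1 : ℕ)) * g (hybrid (s + 1)) := by
          rw [← mul_assoc, ← Real.exp_add]
          push_cast
          ring_nf
  simpa [hybrid] using le_hybrid M le_rfl

namespace CuratorProtocol

variable {M : ℕ} {Z O : Type} [MeasurableSpace O]

/-- The referee of a curator protocol, seen as an adversary of the curator. -/
def refereeAdversary (P : CuratorProtocol M Z O) : Adversary where
  Coins := P.RefCoins
  law := P.refLaw
  query a replies := P.query a (replies.map fun r _ => r) ()
  measurable_query _ := P.measurable_query _ ()
  Out := O
  output a replies := P.output a (replies.map fun r _ => r)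
  measurable_output _ := P.measurable_output _

lemma run_eq_interact (P : CuratorProtocol M Z O) (x : Unit → Fin M → Z)
    (ω : (i : Unit) → (P.party i).Coins) (ρ : P.RefCoins) (t : ℕ) :
    P.run x ω ρ t =
      (fun _ => ((P.party ()).interact (refereeAdversary P) (x ()) (ω ()) ρ t).1,
        ((P.party ()).interact (refereeAdversary P) (x ()) (ω ()) ρ t).2.map fun r _ => r) := by
  induction t with
  | zero => rfl
  | succ t ih =>
    simp only [Protocol.run, ih, Party.interact]
    rfl

lemma outcome_eq_output_interact (P : CuratorProtocol M Z O) (x : Unit → Fin M → Z)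
    (ω : (i : Unit) → (P.party i).Coins) (ρ : P.RefCoins) :
    P.outcome x ω ρ = (refereeAdversary P).output ρ
      ((P.party ()).interact (refereeAdversary P) (x ()) (ω ()) ρ P.rounds).2 := by
  rw [Protocol.outcome, run_eq_interact]
  rfl

variable [MeasurableSpace Z] [MeasurableSingletonClass Z] [Countable Z]

lemma advProb_refereeAdversary (P : CuratorProtocol M Z O) (x : Fin M → Z)
    {T : Set O} (hT : MeasurableSet T) :
    (P.party ()).advProb P.rounds (refereeAdversary P) x T =
      P.coinLaw.real {s | P.outcome (fun _ => x) s.1 s.2 ∈ T} := by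
  have eval_preserving := (measurePreserving_eval (fun i : Unit => (P.party i).law) ()).prod
    (MeasurePreserving.id P.refLaw)
  have h_meas : MeasurableSet {s : (P.party ()).Coins × P.RefCoins |
      P.outcome (fun _ => x) (fun _ => s.1) s.2 ∈ T} :=
    ((P.measurable_outcome_of_data fun _ => x).comp
      (f := fun s : (P.party ()).Coins × P.RefCoins => ((fun _ => s.1), s.2)) (by fun_prop)) hT
  simp only [outcome_eq_output_interact] at h_meas ⊢
  exact (eval_preserving.measureReal_preimage h_meas.nullMeasurableSet).symm

lemma sum_outputLaw_le [Nonempty Z] (P : CuratorProtocol M Z O) {ε : ℝ} (hP : P.IsDP ε)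
    {κ : Type*} [Fintype κ] (ν : κ → Measure Z) [∀ k, IsProbabilityMeasure (ν k)] (T : κ → Set O)
    (hT : ∀ k, MeasurableSet (T k)) {B : ℝ} (hB : ∀ o, ({k | o ∈ T k}.ncard : ℝ) ≤ B) :
    ∑ k, (P.outputLaw (ν k)).real (T k) ≤ Real.exp (ε * M) * B := by
  obtain ⟨z₀⟩ := ‹Nonempty Z›
  have group_privacy (k : κ) (x : Unit → Fin M → Z) :
      P.coinLaw.real {s | P.outcome x s.1 s.2 ∈ T k} ≤
        Real.exp (ε * M) * P.coinLaw.real {s | P.outcome (fun _ _ => z₀) s.1 s.2 ∈ T k} := by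
    rw [← advProb_refereeAdversary P (x ()) (hT k), ← advProb_refereeAdversary P _ (hT k)]
    exact le_exp_mul_of_neighboring (g := fun x =>
      (P.party ()).advProb P.rounds (refereeAdversary P) x (T k))
      (fun x x' hx => by simpa using hP () (refereeAdversary P) x x' hx (T k) (hT k)) _ _
  calc ∑ k, (P.outputLaw (ν k)).real (T k)
      ≤ ∑ k, Real.exp (ε * M) * P.coinLaw.real {s | P.outcome (fun _ _ => z₀) s.1 s.2 ∈ T k} :=
        Finset.sum_le_sum fun k _ => P.outputLaw_real_le_of_forall (ν k) (hT k) (group_privacy k)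
    _ ≤ Real.exp (ε * M) * B := by
        rw [← Finset.mul_sum]
        gcongr
        exact sum_measureReal_le_of_card_le P.coinLaw _
          (fun k => P.measurable_outcome_of_data _ (hT k)) fun s => hB _

end CuratorProtocol

/-- The concept `(x, y) ↦ Par_k(x) ⊕ Thr_t(y)`. -/
def concept {b c : ℕ} (k : Bits c) (t : Bits b) : Bits c × Bits b → Bool := fun z =>
  xor (par k z.1) (thr t z.2)

lemma concept_mem_parityThresh {b c : ℕ} (k : Bits c) (t : Bits b) :
    concept k t ∈ ParityThresh b c :=
  ⟨k, t, rfl⟩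

/-- The uniform distribution on the pairs of the zero string and a branch point of `t`. -/
noncomputable def branchMeasure {b : ℕ} (c : ℕ) (t : Bits b) : Measure (Bits c × Bits b) :=
  (ProbabilityTheory.uniformOn Set.univ).map fun j => (fun _ => false, branchPoint t j)

instance {b c : ℕ} [NeZero b] (t : Bits b) : IsProbabilityMeasure (branchMeasure c t) :=
  Measure.isProbabilityMeasure_map (by fun_prop)

lemma genError_branchMeasure {b c : ℕ} (t : Bits b) (h : Bits c × Bits b → Bool) :
    genError (branchMeasure c t) (concept (fun _ => false) t) h =
      (#{j | branchErrors (fun y => h (fun _ => false, y)) t j = true} : ℝ) / b := by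
  rw [branchMeasure, genError_map_uniformOn]
  simp [branchErrors, concept, par]

-- Each hypothesis is good for few thresholds, each on its own branch distribution, while group
-- privacy makes every output almost equally likely on all of them.
theorem curator_lower_bound {b c M : ℕ} [NeZero b]
    (P : CuratorProtocol M ((Bits c × Bits b) × Bool) (Bits c × Bits b → Bool)) {ε α β : ℝ}
    (hdp : P.IsDP ε) (hpac : P.IsPACLearner (ParityThresh b c) α β) :
    (1 - β) * 2 ^ b ≤ Real.exp (ε * M) * ((3 / 2) ^ b * 2 ^ (α * b)) := by
  let f (t : Bits b) : Bits c × Bits b → Bool := concept (fun _ => false) t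
  have card_good_le (h : Bits c × Bits b → Bool) :
      ({t | h ∈ {h | genError (branchMeasure c t) (f t) h ≤ α}}.ncard : ℝ) ≤
        (3 / 2) ^ b * 2 ^ (α * b) := by
    have hb : (0 : ℝ) < b := by exact_mod_cast Nat.pos_of_neZero b
    simpa only [f, Set.mem_ofPred_eq, genError_branchMeasure, div_le_iff₀ hb,
      Set.ncard_eq_toFinset_card', Set.toFinset_ofPred]
      using card_branchErrors_le (fun y => h (fun _ => false, y)) α
  calc (1 - β) * 2 ^ b = ∑ _t : Bits b, (1 - β) := by simp [sub_mul, mul_comm]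
    _ ≤ ∑ t, (P.outputLaw (labeledLaw (branchMeasure c t) (f t))).real
          {h | genError (branchMeasure c t) (f t) h ≤ α} :=
        Finset.sum_le_sum fun t _ => hpac.le_outputLaw (concept_mem_parityThresh _ t) _
    _ ≤ Real.exp (ε * M) * ((3 / 2) ^ b * 2 ^ (α * b)) :=
        CuratorProtocol.sum_outputLaw_le P hdp _ _
          (fun t => measurableSet_genError_le _ _ _) card_good_le

/-! ## A lower bound for the local model -/

lemma one_sub_sum_abs_le_prod {ι : Type*} (s : Finset ι) {u : ι → ℝ} (hu : ∀ i, 0 ≤ u i) :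
    1 - ∑ i ∈ s, |u i - 1| ≤ ∏ i ∈ s, u i := by
  induction s using Finset.cons_induction with
  | empty => simp
  | cons a s ha ih =>
    rw [Finset.sum_cons, Finset.prod_cons]
    have prod_nonneg : 0 ≤ ∏ i ∈ s, u i := Finset.prod_nonneg fun i _ => hu i
    have sum_nonneg : 0 ≤ ∑ i ∈ s, |u i - 1| := Finset.sum_nonneg fun i _ => abs_nonneg _
    rcases le_total 1 (u a) with one_le | le_one
    · rw [abs_of_nonneg (by linarith)]
      nlinarith
    · rw [abs_of_nonpos (by linarith)]
      nlinarith [hu a]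

section Countable

variable {α : Type*} [Countable α] [MeasurableSpace α] [MeasurableSingletonClass α]

lemma measureReal_le_add_integral_of_singleton_le (μ ν : Measure α) [IsFiniteMeasure μ]
    [IsFiniteMeasure ν] {A : α → ℝ} (hA : ∀ a, 0 ≤ A a) (hA_int : Integrable A μ)
    (h : ∀ a, μ.real {a} ≤ ν.real {a} + A a * μ.real {a}) (S : Set α) :
    μ.real S ≤ ν.real S + ∫ a, A a ∂μ := by
  have lintegral_bound : μ S ≤ ν S + ∫⁻ a, ENNReal.ofReal (A a) ∂μ := by
    have hS : MeasurableSet S := S.to_countable.measurableSet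
    rw [← μ.tsum_indicator_apply_singleton S hS, ← ν.tsum_indicator_apply_singleton S hS,
      lintegral_countable', ← ENNReal.tsum_add]
    refine ENNReal.tsum_le_tsum fun a => ?_
    by_cases ha : a ∈ S
    · simp only [Set.indicator_of_mem ha]
      rw [← ofReal_measureReal (μ := μ), ← ofReal_measureReal (μ := ν),
        ← ENNReal.ofReal_mul (hA a), ← ENNReal.ofReal_add measureReal_nonneg
          (mul_nonneg (hA a) measureReal_nonneg)]
      exact ENNReal.ofReal_le_ofReal (h a)
    · simp [ha]
  rw [← ofReal_integral_eq_lintegral_ofReal hA_int (ae_of_all _ hA),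
    ← ofReal_measureReal (μ := μ), ← ofReal_measureReal (μ := ν),
    ← ENNReal.ofReal_add measureReal_nonneg (integral_nonneg hA)] at lintegral_bound
  exact (ENNReal.ofReal_le_ofReal_iff
    (add_nonneg measureReal_nonneg (integral_nonneg hA))).1 lintegral_bound

lemma sum_measureReal_le_add_of_singleton_le {κ : Type*} [Fintype κ] (μ : κ → Measure α)
    [∀ k, IsProbabilityMeasure (μ k)] (μ₀ : Measure α) [IsProbabilityMeasure μ₀]
    {A : κ → α → ℝ} (hA : ∀ k a, 0 ≤ A k a) {C : ℝ} (hC : ∀ a, ∑ k, A k a ≤ C)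
    (h : ∀ k a, μ₀.real {a} ≤ (μ k).real {a} + A k a * μ₀.real {a}) (T : κ → Set α) {B : ℝ}
    (hB : ∀ a, ({k | a ∈ T k}.ncard : ℝ) ≤ B) : ∑ k, (μ k).real (T k) ≤ B + C := by
  have measurableSet_any (S : Set α) : MeasurableSet S := S.to_countable.measurableSet
  have measurable_any (f : α → ℝ) : Measurable f := fun _ _ => measurableSet_any _
  have A_le (k : κ) (a : α) : A k a ≤ C :=
    (Finset.single_le_sum (f := fun k => A k a) (fun k _ => hA k a)
      (Finset.mem_univ k)).trans (hC a)
  have A_integrable (k : κ) : Integrable (A k) μ₀ :=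
    .of_bound (measurable_any _).aestronglyMeasurable C
      (ae_of_all _ fun a => (Real.norm_of_nonneg (hA k a)).trans_le (A_le k a))
  have transfer (k : κ) : (μ k).real (T k) ≤ μ₀.real (T k) + ∫ a, A k a ∂μ₀ := by
    have compl_le :=
      measureReal_le_add_integral_of_singleton_le μ₀ (μ k) (hA k) (A_integrable k) (h k) (T k)ᶜ
    rw [probReal_compl_eq_one_sub (measurableSet_any _),
      probReal_compl_eq_one_sub (measurableSet_any _)] at compl_le
    linarith
  calc ∑ k, (μ k).real (T k) ≤ ∑ k, (μ₀.real (T k) + ∫ a, A k a ∂μ₀) :=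
        Finset.sum_le_sum fun k _ => transfer k
    _ = ∑ k, μ₀.real (T k) + ∫ a, ∑ k, A k a ∂μ₀ := by
        rw [Finset.sum_add_distrib, integral_finsetSum _ fun k _ => A_integrable k]
    _ ≤ B + ∫ _, C ∂μ₀ :=
        add_le_add (sum_measureReal_le_of_card_le μ₀ T (fun k => measurableSet_any _) hB)
          (integral_mono (integrable_finsetSum _ fun k _ => A_integrable k) (integrable_const _) hC)
    _ = B + C := by simp

end Countable

namespace Protocol

variable {ι : Type} {ℓ : ι → ℕ} {Z O : Type} [MeasurableSpace O]

/-- The messages that party `i` has received when it answers after the replies `π`, most recent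
one first. -/
def received (P : Protocol ι ℓ Z O) (ρ : P.RefCoins) (i : ι) : List (ι → Msg) → List Msg
  | [] => [P.query ρ [] i]
  | r :: π => P.query ρ (r :: π) i :: P.received ρ i π

/-- The input `x` and the coins `ω` of party `i` lead to its replies in the transcript `π`, if the
referee asks what it asks when the replies are `π`. The transcripts that actually occur are thus cut
out by one condition per party, which makes their distribution a product. -/
def Consistent (P : Protocol ι ℓ Z O) (ρ : P.RefCoins) (i : ι) (x : Fin (ℓ i) → Z)
    (ω : (P.party i).Coins) : List (ι → Msg) → Prop
  | [] => True
  | r :: π => P.Consistent ρ i x ω π ∧ (P.party i).next x ω (P.received ρ i π) = r i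

lemma query_cons_run (P : Protocol ι ℓ Z O) (x : (i : ι) → Fin (ℓ i) → Z)
    (ω : (i : ι) → (P.party i).Coins) (ρ : P.RefCoins) (t : ℕ) (i : ι) :
    P.query ρ (P.run x ω ρ t).2 i :: (P.run x ω ρ t).1 i = P.received ρ i (P.run x ω ρ t).2 := by
  induction t with
  | zero => rfl
  | succ t ih => simp only [run, received, ih]

lemma run_eq_iff (P : Protocol ι ℓ Z O) (x : (i : ι) → Fin (ℓ i) → Z)
    (ω : (i : ι) → (P.party i).Coins) (ρ : P.RefCoins) (t : ℕ) (π : List (ι → Msg)) :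
    (P.run x ω ρ t).2 = π ↔ π.length = t ∧ ∀ i, P.Consistent ρ i (x i) (ω i) π := by
  induction t generalizing π with
  | zero =>
    cases π with
    | nil => simp [run, Consistent]
    | cons r π => simp [run]
  | succ t ih =>
    cases π with
    | nil => simp [run]
    | cons r π =>
      simp only [run, query_cons_run, List.cons.injEq, List.length_cons, Nat.add_right_cancel_iff,
        Consistent, forall_and]
      constructor
      · rintro ⟨h_reply, h_run⟩
        obtain ⟨h_length, h_consistent⟩ := (ih π).1 h_run
        exact ⟨h_length, h_consistent, fun i => by rw [← h_reply, h_run]⟩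
      · rintro ⟨h_length, h_consistent, h_reply⟩
        have h_run := (ih π).2 ⟨h_length, h_consistent⟩
        exact ⟨funext fun i => by rw [h_run, h_reply], h_run⟩

/-- The probability that party `i` with input `x` gives its replies in the transcript `π`. -/
noncomputable def replyProb (P : Protocol ι ℓ Z O) (ρ : P.RefCoins) (i : ι) (π : List (ι → Msg))
    (x : Fin (ℓ i) → Z) : ℝ :=
  (P.party i).law.real {ω | P.Consistent ρ i x ω π}

/-- The adversary that sends the messages of the referee in the execution with transcript `π`. -/
noncomputable def scriptAdversary (P : Protocol ι ℓ Z O) (ρ : P.RefCoins) (i : ι)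
    (π : List (ι → Msg)) : Adversary where
  Coins := Unit
  law := Measure.dirac ()
  query _ replies := P.query ρ (π.drop (π.length - replies.length)) i
  measurable_query _ := measurable_const
  Out := List Msg
  output _ replies := replies
  measurable_output _ := measurable_const

lemma interact_scriptAdversary (P : Protocol ι ℓ Z O) (ρ : P.RefCoins) (i : ι)
    (π : List (ι → Msg)) (x : Fin (ℓ i) → Z) (ω : (P.party i).Coins) {σ : List (ι → Msg)}
    (hσ : σ <:+ π) :
    let s := (P.party i).interact (P.scriptAdversary ρ i π) x ω () σ.length
    s.2.length = σ.length ∧ P.query ρ σ i :: s.1 = P.received ρ i σ ∧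
      (s.2 = σ.map (fun r => r i) ↔ P.Consistent ρ i x ω σ) := by
  induction σ with
  | nil => exact ⟨rfl, rfl, by simp [Party.interact, Consistent]⟩
  | cons r σ ih =>
    have hσ' : σ <:+ π := (List.suffix_cons r σ).trans hσ
    obtain ⟨h_length, h_received, h_replies⟩ := ih hσ'
    have h_query : (P.scriptAdversary ρ i π).query ()
        ((P.party i).interact (P.scriptAdversary ρ i π) x ω () σ.length).2 = P.query ρ σ i := by
      simp only [scriptAdversary] at h_length ⊢
      rw [h_length, ← List.suffix_iff_eq_drop.1 hσ']
    simp only [List.length_cons, Party.interact, h_query, h_received, h_length, received,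
      List.map_cons, List.cons.injEq, Consistent, true_and, h_replies]
    exact and_comm

lemma advProb_scriptAdversary (P : Protocol ι ℓ Z O) (ρ : P.RefCoins) (i : ι)
    {π : List (ι → Msg)} (hπ : π.length = P.rounds) (x : Fin (ℓ i) → Z) :
    (P.party i).advProb P.rounds (P.scriptAdversary ρ i π) x {π.map fun r => r i} =
      P.replyProb ρ i π x := by
  have event_eq : {s : (P.party i).Coins × Unit | (P.scriptAdversary ρ i π).output s.2
      ((P.party i).interact (P.scriptAdversary ρ i π) x s.1 s.2 P.rounds).2 ∈
        ({π.map fun r => r i} : Set (List Msg))} =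
      {ω | P.Consistent ρ i x ω π} ×ˢ Set.univ := by
    ext ⟨ω, u⟩
    rw [← hπ]
    exact (P.interact_scriptAdversary ρ i π x ω List.suffix_rfl).2.2.trans (by simp)
  exact (congrArg _ event_eq).trans <| (measureReal_prod_prod _ _).trans <|
    (congrArg _ probReal_univ).trans (mul_one _)

lemma IsDP.replyProb_le {P : Protocol ι ℓ Z O} {ε : ℝ} (hP : P.IsDP ε) (ρ : P.RefCoins) (i : ι)
    {π : List (ι → Msg)} (hπ : π.length = P.rounds) {x x' : Fin (ℓ i) → Z}
    (hx : Neighboring x x') :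
    P.replyProb ρ i π x ≤ Real.exp ε * P.replyProb ρ i π x' := by
  simpa [P.advProb_scriptAdversary ρ i hπ] using
    hP i (P.scriptAdversary ρ i π) x x' hx {π.map fun r => r i} trivial

section Measurability

variable [Finite ι] [MeasurableSpace Z] [Countable Z] [MeasurableSingletonClass Z]

lemma measurable_transcript (P : Protocol ι ℓ Z O) (ρ : P.RefCoins) :
    Measurable fun s : ((i : ι) → Fin (ℓ i) → Z) × ((i : ι) → (P.party i).Coins) =>
      (P.run s.1 s.2 ρ P.rounds).2 :=
  (P.measurable_run P.rounds).snd.comp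
    (f := fun s : ((i : ι) → Fin (ℓ i) → Z) × ((i : ι) → (P.party i).Coins) => (s.1, s.2, ρ))
    (by fun_prop)

lemma measurableSet_outcome_slice (P : Protocol ι ℓ Z O) {T : Set O} (hT : MeasurableSet T) :
    MeasurableSet {s : P.RefCoins × ((i : ι) → Fin (ℓ i) → Z) × ((i : ι) → (P.party i).Coins) |
      P.outcome s.2.1 s.2.2 s.1 ∈ T} :=
  (P.measurable_outcome.comp (f := fun s : P.RefCoins × ((i : ι) → Fin (ℓ i) → Z) ×
    ((i : ι) → (P.party i).Coins) => (s.2.1, s.2.2, s.1)) (by fun_prop)) hT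

end Measurability

section Transcript

variable [Fintype ι] [MeasurableSpace Z]

/-- The distribution of the transcript of all replies for fixed coins `ρ` of the referee, when the
input of party `i` is drawn from `μ i`. -/
noncomputable def transcriptLaw (P : Protocol ι ℓ Z O) (ρ : P.RefCoins)
    (μ : (i : ι) → Measure (Fin (ℓ i) → Z)) : Measure (List (ι → Msg)) :=
  ((Measure.pi μ).prod (Measure.pi fun i => (P.party i).law)).map
    fun s => (P.run s.1 s.2 ρ P.rounds).2

variable [Countable Z] [MeasurableSingletonClass Z]

instance (P : Protocol ι ℓ Z O) (ρ : P.RefCoins) (μ : (i : ι) → Measure (Fin (ℓ i) → Z))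
    [∀ i, IsProbabilityMeasure (μ i)] : IsProbabilityMeasure (P.transcriptLaw ρ μ) :=
  Measure.isProbabilityMeasure_map (P.measurable_transcript ρ).aemeasurable

lemma transcriptLaw_real_singleton (P : Protocol ι ℓ Z O) (ρ : P.RefCoins)
    (μ : (i : ι) → Measure (Fin (ℓ i) → Z)) [∀ i, IsProbabilityMeasure (μ i)]
    {π : List (ι → Msg)} (hπ : π.length = P.rounds) :
    (P.transcriptLaw ρ μ).real {π} = ∏ i, ∫ x, P.replyProb ρ i π x ∂(μ i) := by
  have event_eq : (fun s : ((i : ι) → Fin (ℓ i) → Z) × ((i : ι) → (P.party i).Coins) =>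
      (P.run s.1 s.2 ρ P.rounds).2) ⁻¹' {π} =
        {s | ∀ i, P.Consistent ρ i (s.1 i) (s.2 i) π} := by
    ext s
    simp [run_eq_iff, hπ]
  have slice_eq (x : (i : ι) → Fin (ℓ i) → Z) :
      Prod.mk x ⁻¹' {s : ((i : ι) → Fin (ℓ i) → Z) × ((i : ι) → (P.party i).Coins) |
        ∀ i, P.Consistent ρ i (s.1 i) (s.2 i) π} =
        Set.pi Set.univ fun i => {ω | P.Consistent ρ i (x i) ω π} := by
    ext ω
    simp
  rw [transcriptLaw, map_measureReal_apply (P.measurable_transcript ρ) (measurableSet_singleton π),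
    measureReal_prod_eq_integral _ _ (P.measurable_transcript ρ (measurableSet_singleton π)),
    event_eq, ← integral_fintype_prod_eq_prod (f := fun i x => P.replyProb ρ i π x)]
  refine integral_congr_ae (ae_of_all _ fun x => ?_)
  simp only [slice_eq]
  rw [measureReal_def, Measure.pi_pi, ENNReal.toReal_prod]
  rfl

lemma transcriptLaw_real_singleton_of_length_ne (P : Protocol ι ℓ Z O) (ρ : P.RefCoins)
    (μ : (i : ι) → Measure (Fin (ℓ i) → Z)) {π : List (ι → Msg)} (hπ : π.length ≠ P.rounds) :
    (P.transcriptLaw ρ μ).real {π} = 0 := by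
  have event_eq : (fun s : ((i : ι) → Fin (ℓ i) → Z) × ((i : ι) → (P.party i).Coins) =>
      (P.run s.1 s.2 ρ P.rounds).2) ⁻¹' {π} = ∅ := by
    ext s
    simp [run_eq_iff, hπ]
  rw [transcriptLaw, map_measureReal_apply (P.measurable_transcript ρ) (measurableSet_singleton π),
    event_eq, measureReal_empty]

lemma real_prod_outcome_slice_eq_transcriptLaw (P : Protocol ι ℓ Z O) (ρ : P.RefCoins)
    (μ : (i : ι) → Measure (Fin (ℓ i) → Z)) (T : Set O) :
    ((Measure.pi μ).prod (Measure.pi fun i => (P.party i).law)).real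
      (Prod.mk ρ ⁻¹' {s | P.outcome s.2.1 s.2.2 s.1 ∈ T}) =
        (P.transcriptLaw ρ μ).real {π | P.output ρ π ∈ T} :=
  (map_measureReal_apply (s := {π | P.output ρ π ∈ T}) (P.measurable_transcript ρ) trivial).symm

lemma integrable_transcriptLaw_real (P : Protocol ι ℓ Z O)
    (μ : (i : ι) → Measure (Fin (ℓ i) → Z)) [∀ i, IsProbabilityMeasure (μ i)] {T : Set O}
    (hT : MeasurableSet T) :
    Integrable (fun ρ => (P.transcriptLaw ρ μ).real {π | P.output ρ π ∈ T}) P.refLaw := by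
  simpa only [real_prod_outcome_slice_eq_transcriptLaw] using
    integrable_measureReal_prodMk_left P.refLaw
      ((Measure.pi μ).prod (Measure.pi fun i => (P.party i).law))
      (P.measurableSet_outcome_slice hT)

lemma outputLaw_real_eq_integral (P : Protocol ι ℓ Z O) (ν : Measure Z) [IsProbabilityMeasure ν]
    {T : Set O} (hT : MeasurableSet T) :
    (P.outputLaw ν).real T =
      ∫ ρ, (P.transcriptLaw ρ fun _ => Measure.pi fun _ => ν).real {π | P.output ρ π ∈ T}
        ∂P.refLaw := by
  let data : Measure ((i : ι) → Fin (ℓ i) → Z) := Measure.pi fun _ => Measure.pi fun _ => ν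
  let coins := Measure.pi fun i => (P.party i).law
  have reorder_preserving := (measurePreserving_prodAssoc data coins P.refLaw).comp
    (Measure.measurePreserving_swap (μ := P.refLaw) (ν := data.prod coins))
  rw [P.outputLaw_real_apply ν hT]
  refine (reorder_preserving.measureReal_preimage
    (P.measurable_outcome hT).nullMeasurableSet).symm.trans ?_
  exact (measureReal_prod_eq_integral _ _ (P.measurableSet_outcome_slice hT)).trans <|
    integral_congr_ae <| ae_of_all _ fun ρ => P.real_prod_outcome_slice_eq_transcriptLaw ρ _ T

end Transcript

end Protocol

namespace LocalProtocol

variable {N : ℕ} {Z O : Type} [MeasurableSpace O] [MeasurableSpace Z]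

/-- The probability that agent `i` gives its replies in the transcript `π`, when its data point is
drawn from `ν`. -/
noncomputable def meanReplyProb (P : LocalProtocol N Z O) (ρ : P.RefCoins) (i : Fin N)
    (π : List (Fin N → Msg)) (ν : Measure Z) : ℝ :=
  ∫ z, P.replyProb ρ i π (fun _ => z) ∂ν

/-- The relative error, up to second order terms, of the probability of the transcript `π` when the
data points are drawn from `ν` instead of `ν₀`. -/
noncomputable def transcriptDeviation (P : LocalProtocol N Z O) (ρ : P.RefCoins) (ν ν₀ : Measure Z)
    (π : List (Fin N → Msg)) : ℝ :=
  if π.length = P.rounds then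
    ∑ i, |meanReplyProb P ρ i π ν - meanReplyProb P ρ i π ν₀| / meanReplyProb P ρ i π ν₀
  else 0

lemma meanReplyProb_nonneg (P : LocalProtocol N Z O) (ρ : P.RefCoins) (i : Fin N)
    (π : List (Fin N → Msg)) (ν : Measure Z) : 0 ≤ meanReplyProb P ρ i π ν :=
  integral_nonneg fun _ => measureReal_nonneg

lemma transcriptDeviation_nonneg (P : LocalProtocol N Z O) (ρ : P.RefCoins) (ν ν₀ : Measure Z)
    (π : List (Fin N → Msg)) : 0 ≤ transcriptDeviation P ρ ν ν₀ π := by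
  unfold transcriptDeviation
  split_ifs
  · exact Finset.sum_nonneg fun i _ => div_nonneg (abs_nonneg _) (meanReplyProb_nonneg P ρ i π ν₀)
  · exact le_rfl

/-- The distribution of the transcript for fixed coins `ρ` of the referee, when all data points are
drawn from `ν`. -/
noncomputable abbrev iidTranscriptLaw (P : LocalProtocol N Z O) (ρ : P.RefCoins) (ν : Measure Z) :
    Measure (List (Fin N → Msg)) :=
  P.transcriptLaw ρ fun _ => Measure.pi fun _ => ν

lemma integral_pi_replyProb (P : LocalProtocol N Z O) (ρ : P.RefCoins) (i : Fin N)
    (π : List (Fin N → Msg)) (ν : Measure Z) [SigmaFinite ν] :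
    ∫ x, P.replyProb ρ i π x ∂(Measure.pi fun _ => ν) = meanReplyProb P ρ i π ν :=
  ((measurePreserving_funUnique ν (Fin 1)).symm.integral_comp
    (MeasurableEquiv.measurableEmbedding _) fun x => P.replyProb ρ i π x).symm

variable {κ : Type*} [Fintype κ] {ν : κ → Measure Z} {ν₀ : Measure Z} {ε Δ B : ℝ}

lemma sum_transcriptDeviation_le (P : LocalProtocol N Z O) (hP : P.IsDP ε) (hΔ₀ : 0 ≤ Δ)
    (hΔ : ∀ w : Z → ℝ, (∀ z, 0 ≤ w z) → (∀ z z', w z ≤ Real.exp ε * w z') →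
      ∑ k, |∫ z, w z ∂(ν k) - ∫ z, w z ∂ν₀| ≤ Δ * ∫ z, w z ∂ν₀)
    (ρ : P.RefCoins) (π : List (Fin N → Msg)) :
    ∑ k, transcriptDeviation P ρ (ν k) ν₀ π ≤ N * Δ := by
  by_cases hπ : π.length = P.rounds
  · simp only [transcriptDeviation, if_pos hπ]
    rw [Finset.sum_comm]
    have agent_bound (i : Fin N) :
        ∑ k, |meanReplyProb P ρ i π (ν k) - meanReplyProb P ρ i π ν₀| / meanReplyProb P ρ i π ν₀ ≤
          Δ := by
      rw [← Finset.sum_div]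
      exact div_le_of_le_mul₀ (meanReplyProb_nonneg P ρ i π ν₀) hΔ₀ <|
        hΔ _ (fun _ => measureReal_nonneg) fun z z' => hP.replyProb_le ρ i hπ
          ⟨0, fun j hj => absurd (Subsingleton.elim j 0) hj⟩
    exact (Finset.sum_le_sum fun i _ => agent_bound i).trans_eq (by simp)
  · simp only [transcriptDeviation, if_neg hπ, Finset.sum_const_zero]
    positivity

variable [Countable Z] [MeasurableSingletonClass Z]

lemma iidTranscriptLaw_singleton_le (P : LocalProtocol N Z O) (ρ : P.RefCoins) (ν ν₀ : Measure Z)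
    [IsProbabilityMeasure ν] [IsProbabilityMeasure ν₀] (π : List (Fin N → Msg)) :
    (iidTranscriptLaw P ρ ν₀).real {π} ≤ (iidTranscriptLaw P ρ ν).real {π} +
      transcriptDeviation P ρ ν ν₀ π * (iidTranscriptLaw P ρ ν₀).real {π} := by
  by_cases hπ : π.length = P.rounds
  · simp only [P.transcriptLaw_real_singleton ρ _ hπ, integral_pi_replyProb]
    have nonneg := meanReplyProb_nonneg P ρ (π := π)
    by_cases h_zero : ∃ i, meanReplyProb P ρ i π ν₀ = 0
    · obtain ⟨i, hi⟩ := h_zero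
      rw [Finset.prod_eq_zero (Finset.mem_univ i) hi, mul_zero, add_zero]
      exact Finset.prod_nonneg fun i _ => nonneg i ν
    · push Not at h_zero
      have ratio_bound := one_sub_sum_abs_le_prod Finset.univ
        (u := fun i => meanReplyProb P ρ i π ν / meanReplyProb P ρ i π ν₀)
        fun i => div_nonneg (nonneg i ν) (nonneg i ν₀)
      have deviation_eq : ∑ i, |meanReplyProb P ρ i π ν / meanReplyProb P ρ i π ν₀ - 1| =
          transcriptDeviation P ρ ν ν₀ π := by
        rw [transcriptDeviation, if_pos hπ]
        refine Finset.sum_congr rfl fun i _ => ?_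
        rw [← div_self (h_zero i), ← sub_div, abs_div, abs_of_nonneg (nonneg i ν₀)]
      rw [deviation_eq, Finset.prod_div_distrib, le_div_iff₀ (Finset.prod_pos fun i _ =>
        (nonneg i ν₀).lt_of_ne' (h_zero i))] at ratio_bound
      linarith
  · simp [P.transcriptLaw_real_singleton_of_length_ne ρ _ hπ]

theorem sum_outputLaw_le (P : LocalProtocol N Z O) (hP : P.IsDP ε)
    [∀ k, IsProbabilityMeasure (ν k)] [IsProbabilityMeasure ν₀] (hΔ₀ : 0 ≤ Δ)
    (hΔ : ∀ w : Z → ℝ, (∀ z, 0 ≤ w z) → (∀ z z', w z ≤ Real.exp ε * w z') →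
      ∑ k, |∫ z, w z ∂(ν k) - ∫ z, w z ∂ν₀| ≤ Δ * ∫ z, w z ∂ν₀)
    {T : κ → Set O} (hT : ∀ k, MeasurableSet (T k)) (hB : ∀ o, ({k | o ∈ T k}.ncard : ℝ) ≤ B) :
    ∑ k, (P.outputLaw (ν k)).real (T k) ≤ B + N * Δ := by
  have integrable_k (k : κ) := P.integrable_transcriptLaw_real
    (fun _ => Measure.pi fun _ => ν k) (hT k)
  have conditional_bound (ρ : P.RefCoins) :
      ∑ k, (iidTranscriptLaw P ρ (ν k)).real {π | P.output ρ π ∈ T k} ≤ B + N * Δ :=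
    sum_measureReal_le_add_of_singleton_le _ (iidTranscriptLaw P ρ ν₀)
      (fun k => transcriptDeviation_nonneg P ρ (ν k) ν₀)
      (sum_transcriptDeviation_le P hP hΔ₀ hΔ ρ)
      (fun k => iidTranscriptLaw_singleton_le P ρ (ν k) ν₀) _ fun π => hB (P.output ρ π)
  calc ∑ k, (P.outputLaw (ν k)).real (T k)
      = ∫ ρ, ∑ k, (iidTranscriptLaw P ρ (ν k)).real {π | P.output ρ π ∈ T k} ∂P.refLaw := by
        rw [integral_finsetSum _ fun k _ => integrable_k k]
        exact Finset.sum_congr rfl fun k _ => P.outputLaw_real_eq_integral (ν k) (hT k)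
    _ ≤ ∫ _, (B + N * Δ) ∂P.refLaw :=
        integral_mono (integrable_finsetSum _ fun k _ => integrable_k k) (integrable_const _)
          conditional_bound
    _ = B + N * Δ := by simp

end LocalProtocol

/-- The distribution of `(x, 0)` for uniform `x`, on which every threshold function is constant if
the threshold is `0`. -/
noncomputable def parityMeasure (b c : ℕ) : Measure (Bits c × Bits b) :=
  (ProbabilityTheory.uniformOn Set.univ).map fun x => (x, fun _ => false)

instance {b c : ℕ} : IsProbabilityMeasure (parityMeasure b c) :=
  Measure.isProbabilityMeasure_map (by fun_prop)

/-- The distribution of `((x, 0), y)` for a uniform string `x` and an independent uniform label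
`y`. -/
noncomputable def randomLabelMeasure (b c : ℕ) : Measure ((Bits c × Bits b) × Bool) :=
  (ProbabilityTheory.uniformOn Set.univ).map
    fun z : Bits c × Bool => ((z.1, fun _ => false), z.2)

instance {b c : ℕ} : IsProbabilityMeasure (randomLabelMeasure b c) :=
  Measure.isProbabilityMeasure_map (by fun_prop)

lemma concept_zero_apply {b c : ℕ} (k x : Bits c) :
    concept (b := b) k (fun _ => false) (x, fun _ => false) = !par k x := by
  simp [concept, thr]

lemma genError_parityMeasure {b c : ℕ} (k : Bits c) (h : Bits c × Bits b → Bool) :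
    genError (parityMeasure b c) (concept k fun _ => false) h =
      (#{x | h (x, fun _ => false) ≠ !par k x} : ℝ) / 2 ^ c := by
  rw [parityMeasure, genError_map_uniformOn]
  simp [concept_zero_apply]

lemma integral_labeledLaw_parityMeasure {b c : ℕ} (k : Bits c)
    (w : (Bits c × Bits b) × Bool → ℝ) :
    ∫ z, w z ∂(labeledLaw (parityMeasure b c) (concept k fun _ => false)) =
      (∑ x, w ((x, fun _ => false), !par k x)) / 2 ^ c := by
  rw [labeledLaw, parityMeasure, Measure.map_map Measurable.of_discrete Measurable.of_discrete,
    integral_map Measurable.of_discrete.aemeasurable Measurable.of_discrete.aestronglyMeasurable,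
    integral_uniformOn_univ]
  simp [concept_zero_apply]

lemma integral_randomLabelMeasure {b c : ℕ} (w : (Bits c × Bits b) × Bool → ℝ) :
    ∫ z, w z ∂(randomLabelMeasure b c) =
      (∑ z : Bits c × Bool, w ((z.1, fun _ => false), z.2)) / 2 ^ (c + 1) := by
  rw [randomLabelMeasure, integral_map Measurable.of_discrete.aemeasurable
    Measurable.of_discrete.aestronglyMeasurable, integral_uniformOn_univ]
  simp [pow_succ]

theorem local_lower_bound {b c N : ℕ}
    (P : LocalProtocol N ((Bits c × Bits b) × Bool) (Bits c × Bits b → Bool)) {ε α β : ℝ}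
    (hα : α < 1 / 2) (hdp : P.IsDP ε) (hpac : P.IsPACLearner (ParityThresh b c) α β) :
    (1 - β) * 2 ^ c ≤ ((1 - 2 * α) ^ 2)⁻¹ + N * (√(2 ^ c) * (Real.exp ε / 2)) := by
  let f (k : Bits c) : Bits c × Bits b → Bool := concept k fun _ => false
  have card_good_le (h : Bits c × Bits b → Bool) :
      ({k | h ∈ {h | genError (parityMeasure b c) (f k) h ≤ α}}.ncard : ℝ) ≤
        ((1 - 2 * α) ^ 2)⁻¹ := by
    rw [← one_div, le_div_iff₀ (pow_pos (by linarith) 2)]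
    simpa only [f, Set.mem_ofPred_eq, genError_parityMeasure, Set.ncard_eq_toFinset_card',
      Set.toFinset_ofPred] using card_parities_close_le (fun x => h (x, fun _ => false)) hα.le
  calc (1 - β) * 2 ^ c = ∑ _k : Bits c, (1 - β) := by simp [sub_mul, mul_comm]
    _ ≤ ∑ k, (P.outputLaw (labeledLaw (parityMeasure b c) (f k))).real
          {h | genError (parityMeasure b c) (f k) h ≤ α} :=
        Finset.sum_le_sum fun k _ => hpac.le_outputLaw (concept_mem_parityThresh _ _) _
    _ ≤ ((1 - 2 * α) ^ 2)⁻¹ + N * (√(2 ^ c) * (Real.exp ε / 2)) := by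
        refine LocalProtocol.sum_outputLaw_le P hdp (ν₀ := randomLabelMeasure b c) (by positivity)
          (fun w w_nonneg w_le => ?_) (fun k => measurableSet_genError_le _ _ _) card_good_le
        simp only [f, integral_labeledLaw_parityMeasure, integral_randomLabelMeasure]
        rw [mul_assoc]
        exact sum_abs_labeled_mean_sub_mean_le (w := fun z => w ((z.1, fun _ => false), z.2))
          (fun z => w_nonneg _) fun z z' => w_le _ _

/-! ## Uniform deviation bounds -/

section Hoeffding

open ProbabilityTheory

lemma measureReal_le_abs_sum_le_of_iIndepFun {Ω ι : Type*} [MeasurableSpace Ω] {μ : Measure Ω}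
    [IsFiniteMeasure μ] {X : ι → Ω → ℝ} (hX : iIndepFun X μ) {v : NNReal} (s : Finset ι)
    (hsub : ∀ i ∈ s, HasSubgaussianMGF (X i) v μ) {r : ℝ} (hr : 0 ≤ r) :
    μ.real {ω | r ≤ |∑ i ∈ s, X i ω|} ≤ 2 * Real.exp (-r ^ 2 / (2 * (#s * v))) := by
  have hupper := HasSubgaussianMGF.measure_sum_ge_le_of_iIndepFun hX hsub hr
  have hlower := HasSubgaussianMGF.measure_sum_ge_le_of_iIndepFun
    (hX.comp (fun _ x => -x) fun _ => measurable_neg) (fun i hi => (hsub i hi).neg) hr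
  simp only [Function.comp_apply, Finset.sum_neg_distrib, Finset.sum_const, nsmul_eq_mul,
    NNReal.coe_mul, NNReal.coe_natCast] at hupper hlower
  rw [two_mul]
  refine (measureReal_mono fun ω hω => ?_).trans
    ((measureReal_union_le _ _).trans (add_le_add hupper hlower))
  exact le_abs.1 (Set.mem_ofPred_eq ▸ hω)

variable {ι : Type*} [Fintype ι] {Ω : ι → Type*} [∀ i, MeasurableSpace (Ω i)]
  (μ : (i : ι) → Measure (Ω i)) [∀ i, IsProbabilityMeasure (μ i)] {B : ℝ}

lemma hasSubgaussianMGF_pi_apply_sub_integral {i : ι} {g : Ω i → ℝ} (hg : Measurable g)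
    (hB : ∀ a, |g a| ≤ B) :
    HasSubgaussianMGF (fun ω => g (ω i) - ∫ a, g a ∂μ i) (‖B‖₊ ^ 2) (Measure.pi μ) := by
  have hoeffding := hasSubgaussianMGF_of_mem_Icc (μ := Measure.pi μ) (X := fun ω => g (ω i))
    (hg.comp (measurable_pi_apply i)).aemeasurable
    (ae_of_all _ fun ω => abs_le.1 (hB (ω i)))
  have integral_eq : ∫ ω, g (ω i) ∂Measure.pi μ = ∫ a, g a ∂μ i := by
    rw [← (measurePreserving_eval μ i).map_eq, integral_map (measurable_pi_apply i).aemeasurable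
      hg.aestronglyMeasurable]
  have half_width : ‖B - -B‖₊ / 2 = ‖B‖₊ := by
    rw [sub_neg_eq_add, ← two_mul, nnnorm_mul, Real.nnnorm_two, mul_div_cancel_left₀ _ two_ne_zero]
  rwa [integral_eq, half_width] at hoeffding

variable (s : Finset ι) {δ : ℝ}

lemma measureReal_le_abs_sum_sub_integral_le {f : (i : ι) → Ω i → ℝ} (hf : ∀ i, Measurable (f i))
    (hB : ∀ i ∈ s, ∀ a, |f i a| ≤ B) (hδ : 0 ≤ δ) :
    (Measure.pi μ).real {ω | #s * δ ≤ |∑ i ∈ s, f i (ω i) - ∑ i ∈ s, ∫ a, f i a ∂μ i|} ≤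
      2 * Real.exp (-(#s * δ ^ 2 / (2 * B ^ 2))) := by
  have indep : iIndepFun (fun i ω => f i (ω i) - ∫ a, f i a ∂μ i) (Measure.pi μ) :=
    iIndepFun_pi (X := fun i a => f i a - ∫ a, f i a ∂μ i)
      fun i => ((hf i).sub_const _).aemeasurable
  have bound := measureReal_le_abs_sum_le_of_iIndepFun indep s
    (fun i hi => hasSubgaussianMGF_pi_apply_sub_integral μ (hf i) (hB i hi))
    (r := #s * δ) (by positivity)
  have exponent : -(#s * δ) ^ 2 / (2 * (#s * B ^ 2)) = -(#s * δ ^ 2 / (2 * B ^ 2)) := by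
    rcases s.card.eq_zero_or_pos with card_zero | card_pos
    · simp [card_zero]
    · rcases eq_or_ne B 0 with rfl | hB0
      · simp
      · field_simp
  simp only [Finset.sum_sub_distrib, NNReal.coe_pow, coe_nnnorm, Real.norm_eq_abs, sq_abs,
    exponent] at bound
  exact bound

lemma measureReal_exists_le_abs_sum_sub_integral_le {A : Type*} [Fintype A]
    {f : A → (i : ι) → Ω i → ℝ} (hf : ∀ a i, Measurable (f a i))
    (hB : ∀ a, ∀ i ∈ s, ∀ x, |f a i x| ≤ B) (hδ : 0 ≤ δ) :
    (Measure.pi μ).real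
        {ω | ∃ a, #s * δ ≤ |∑ i ∈ s, f a i (ω i) - ∑ i ∈ s, ∫ x, f a i x ∂μ i|} ≤
      Fintype.card A * (2 * Real.exp (-(#s * δ ^ 2 / (2 * B ^ 2)))) := by
  rw [Set.ofPred_exists]
  calc _ ≤ ∑ a, (Measure.pi μ).real
          {ω | #s * δ ≤ |∑ i ∈ s, f a i (ω i) - ∑ i ∈ s, ∫ x, f a i x ∂μ i|} :=
        measureReal_iUnion_fintype_le _
    _ ≤ ∑ _a : A, 2 * Real.exp (-(#s * δ ^ 2 / (2 * B ^ 2))) :=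
        Finset.sum_le_sum fun a _ =>
          measureReal_le_abs_sum_sub_integral_le μ s (hf a) (hB a) hδ
    _ = _ := by rw [Finset.sum_const, Finset.card_univ, nsmul_eq_mul]

end Hoeffding

section Sampling

open scoped symmDiff

variable {X : Type*} {m : ℕ}

lemma abs_measureReal_sub_le_of_symmDiff_subset [MeasurableSpace X] [DiscreteMeasurableSpace X]
    (μ : Measure X) [IsFiniteMeasure μ] {E E' B : Set X} (h : E ∆ E' ⊆ B) :
    |μ.real E - μ.real E'| ≤ μ.real B :=
  (abs_measureReal_sub_le_measureReal_symmDiff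
    (MeasurableSet.of_discrete (s := E)).nullMeasurableSet
    MeasurableSet.of_discrete.nullMeasurableSet).trans (measureReal_mono h)

/-- The number of entries of the sample `S` in the set `E`, as a real number. It is a measure of
`E`, so that facts about measures apply to it. -/
noncomputable def sampleCount (S : Fin m → X) (E : Set X) : ℝ :=
  Measure.count.real (S ⁻¹' E)

lemma sampleCount_eq_sum_indicator (S : Fin m → X) (E : Set X) :
    sampleCount S E = ∑ j, E.indicator 1 (S j) := by
  rw [← integral_count, sampleCount, ← integral_indicator_one .of_discrete]
  rfl

lemma abs_sampleCount_sub_le_of_symmDiff_subset (S : Fin m → X) {E E' B : Set X}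
    (h : E ∆ E' ⊆ B) : |sampleCount S E - sampleCount S E'| ≤ sampleCount S B :=
  abs_measureReal_sub_le_of_symmDiff_subset Measure.count (Set.preimage_mono h)

variable [MeasurableSpace X] (D : Measure X)

/-- How far the number of sample points in `E` is from the number expected under `D`. -/
noncomputable def deviation (S : Fin m → X) (E : Set X) : ℝ :=
  |sampleCount S E - m * D.real E|

lemma deviation_le_of_symmDiff_subset [DiscreteMeasurableSpace X] [IsFiniteMeasure D]
    {S : Fin m → X} {E E₀ B : Set X} (h : E ∆ E₀ ⊆ B) {δ : ℝ} (hB : D.real B ≤ δ)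
    (hE₀ : deviation D S E₀ ≤ m * δ) (hB_dev : deviation D S B ≤ m * δ) :
    deviation D S E ≤ m * (4 * δ) := by
  have count_le : |sampleCount S E - sampleCount S E₀| ≤ 2 * (m * δ) := by
    have count_B := (abs_le.1 hB_dev).2
    have expected_B : m * D.real B ≤ m * δ := by gcongr
    linarith [abs_sampleCount_sub_le_of_symmDiff_subset S h]
  have expected_le : |m * D.real E₀ - m * D.real E| ≤ m * δ := by
    rw [← mul_sub, abs_mul, Nat.abs_cast, abs_sub_comm]
    gcongr
    exact (abs_measureReal_sub_le_of_symmDiff_subset D h).trans hB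
  calc deviation D S E
      ≤ |sampleCount S E - sampleCount S E₀| + |sampleCount S E₀ - m * D.real E| :=
        abs_sub_le _ _ _
    _ ≤ 2 * (m * δ) + (deviation D S E₀ + |m * D.real E₀ - m * D.real E|) :=
        add_le_add count_le (abs_sub_le _ _ _)
    _ ≤ m * (4 * δ) := by linarith

lemma measureReal_exists_le_deviation_le [IsProbabilityMeasure D] {A : Type*} [Fintype A]
    {E : A → Set X} (hE : ∀ a, MeasurableSet (E a)) {δ : ℝ} (hδ : 0 ≤ δ) :
    (Measure.pi fun _ : Fin m => D).real {S | ∃ a, m * δ ≤ deviation D S (E a)} ≤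
      Fintype.card A * (2 * Real.exp (-(m * δ ^ 2 / 2))) := by
  have bound := measureReal_exists_le_abs_sum_sub_integral_le (fun _ : Fin m => D) Finset.univ
    (f := fun a _ => (E a).indicator 1) (B := 1)
    (fun a _ => measurable_one.indicator (hE a))
    (fun a _ _ x => by by_cases hx : x ∈ E a <;> simp [hx]) hδ
  simpa only [integral_indicator_one (hE _), Finset.sum_const, Finset.card_univ, Fintype.card_fin,
    nsmul_eq_mul, ← sampleCount_eq_sum_indicator, one_pow, mul_one, deviation]
    using bound

lemma exists_fiberwise_bounds {T I α : Type*} [Finite T] [Nonempty T] [LinearOrder α] (κ : T → I)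
    (v : T → α) : ∃ lo hi : I → T, (∀ i, κ (lo i) = κ (hi i)) ∧
      ∀ t, v (lo (κ t)) ≤ v t ∧ v t ≤ v (hi (κ t)) := by
  have bounds (i : I) : ∃ l h : T, κ l = κ h ∧ ∀ t, κ t = i → v l ≤ v t ∧ v t ≤ v h := by
    rcases (κ ⁻¹' {i}).eq_empty_or_nonempty with empty | nonempty
    · let t₀ := Classical.arbitrary T
      exact ⟨t₀, t₀, rfl, fun t ht => (Set.eq_empty_iff_forall_notMem.1 empty t ht).elim⟩
    · obtain ⟨l, hl, l_le⟩ := Set.exists_min_image _ v (Set.toFinite _) nonempty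
      obtain ⟨h, hh, le_h⟩ := Set.exists_max_image _ v (Set.toFinite _) nonempty
      exact ⟨l, h, hl.trans hh.symm, fun t ht => ⟨l_le t ht, le_h t ht⟩⟩
  choose lo hi same_fiber between using bounds
  exact ⟨lo, hi, same_fiber, fun t => between (κ t) t rfl⟩

lemma sub_le_one_div_of_floor_mul_eq {x y : ℝ} {J : ℕ} (hx : 0 ≤ x) (hJ : 0 < J)
    (h : ⌊x * J⌋₊ = ⌊y * J⌋₊) : y - x ≤ 1 / J := by
  have hJ' : (0 : ℝ) < J := by exact_mod_cast hJ
  have floor_le := Nat.floor_le (mul_nonneg hx hJ'.le)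
  have lt_floor := Nat.lt_floor_add_one (y * J)
  rw [le_div_iff₀ hJ', sub_mul]
  rw [← h] at lt_floor
  linarith

/-- The bracketing argument: only the rank of `D {x | y x < v t}` among the multiples of `1 / J`
matters for `t`, so that the union bound does not see the number of thresholds. -/
lemma measureReal_exists_lt_deviation_le_of_symmDiff_subset [DiscreteMeasurableSpace X]
    [IsProbabilityMeasure D] {A T : Type*} [Fintype A] [Finite T] [Nonempty T] (v : T → ℕ)
    (y : X → ℕ) {R : A → T → Set X}
    (hR : ∀ a s t, R a s ∆ R a t ⊆ {x | y x < v s} ∆ {x | y x < v t}) {J : ℕ} (hJ : 0 < J) :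
    (Measure.pi fun _ : Fin m => D).real
        {S | ∃ a t, m * (4 * (1 / J : ℝ)) < deviation D S (R a t)} ≤
      (Fintype.card A + 1) * (J + 1) * (2 * Real.exp (-(m * (1 / J : ℝ) ^ 2 / 2))) := by
  let F (t : T) : Set X := {x | y x < v t}
  have F_mono {s t : T} (h : v s ≤ v t) : F s ⊆ F t := fun x hx => lt_of_lt_of_le hx h
  let rank (t : T) : Fin (J + 1) := ⟨⌊D.real (F t) * J⌋₊, Nat.lt_succ_iff.2 <|
    Nat.floor_le_of_le <| mul_le_of_le_one_left J.cast_nonneg measureReal_le_one⟩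
  obtain ⟨lo, hi, same_rank, between⟩ := exists_fiberwise_bounds rank v
  let test : Option A × Fin (J + 1) → Set X
    | (none, i) => F (hi i) \ F (lo i)
    | (some a, i) => R a (lo i)
  have measure_bracket (t : T) : D.real (test (none, rank t)) ≤ 1 / J := by
    rw [measureReal_sdiff (F_mono ((between t).1.trans (between t).2)) .of_discrete]
    exact sub_le_one_div_of_floor_mul_eq measureReal_nonneg hJ
      (congrArg Fin.val (same_rank (rank t)))
  have card_tests : (Fintype.card (Option A × Fin (J + 1)) : ℝ) =
      (Fintype.card A + 1) * (J + 1) := by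
    simp
  rw [← card_tests]
  refine (measureReal_mono ?_).trans (measureReal_exists_le_deviation_le D (E := test)
    (fun _ => .of_discrete) (by positivity))
  rintro S ⟨a, t, large⟩
  by_contra! small
  simp only [Set.mem_ofPred_eq, not_exists, not_le] at small
  refine large.not_ge (deviation_le_of_symmDiff_subset D ?_ (measure_bracket t)
    (small (some a, rank t)).le (small (none, rank t)).le)
  refine (hR a t (lo (rank t))).trans fun x hx => ?_
  rcases hx with ⟨hx_t, hx_lo⟩ | ⟨hx_lo, hx_t⟩
  · exact ⟨F_mono (between t).2 hx_t, hx_lo⟩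
  · exact absurd (F_mono (between t).1 hx_lo) hx_t

end Sampling

/-! ## Mechanisms with finitely many messages -/

section Mechanism

variable {O : Type} [Fintype O]

/-- The distribution with the given real point masses. -/
noncomputable def pmfOfReal (w : O → ℝ) (hw : ∀ o, 0 ≤ w o) (hw_sum : ∑ o, w o = 1) : PMF O :=
  PMF.ofFintype (fun o => ENNReal.ofReal (w o)) (by
    rw [← ENNReal.ofReal_sum_of_nonneg fun o _ => hw o, hw_sum, ENNReal.ofReal_one])

lemma toReal_pmfOfReal {w : O → ℝ} (hw : ∀ o, 0 ≤ w o) (hw_sum : ∑ o, w o = 1) (o : O) :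
    (pmfOfReal w hw hw_sum o).toReal = w o :=
  ENNReal.toReal_ofReal (hw o)

lemma toMeasure_real_le_card_mul [MeasurableSpace O] [MeasurableSingletonClass O] (p : PMF O)
    {E : Set O} {B : ℝ} (hB : 0 ≤ B) (hE : ∀ o ∈ E, (p o).toReal ≤ B) :
    p.toMeasure.real E ≤ Fintype.card O * B := by
  rw [← integral_indicator_one .of_discrete, PMF.integral_eq_sum, ← nsmul_eq_mul]
  refine Finset.sum_le_card_nsmul _ _ _ fun o _ => ?_
  by_cases ho : o ∈ E
  · simpa [ho] using hE o ho
  · simpa [ho] using hB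

/-- The messages that stand for the elements of a finite type. -/
noncomputable def encode (o : O) : Msg := Fintype.equivFin O o

lemma encode_injective : Function.Injective (encode : O → Msg) :=
  Fin.val_injective.comp (Fintype.equivFin O).injective

variable [MeasurableSpace O] [MeasurableSingletonClass O] {ℓ : ℕ} {Z : Type} [Fintype Z]

/-- The party whose reply has the distribution `K x` on every input `x`. Its coins are tables with a
reply for every input. -/
noncomputable def mechanismParty (K : (Fin ℓ → Z) → PMF O) : Party ℓ Z where
  Coins := (Fin ℓ → Z) → O
  law := Measure.pi fun x => (K x).toMeasure
  next x ω _ := encode (ω x)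
  measurable_next x _ := (Measurable.of_discrete (f := encode)).comp (measurable_pi_apply x)

lemma measurePreserving_mechanismParty (K : (Fin ℓ → Z) → PMF O) (x : Fin ℓ → Z) :
    MeasurePreserving (fun ω : (mechanismParty K).Coins => (ω : (Fin ℓ → Z) → O) x)
      (mechanismParty K).law (K x).toMeasure :=
  measurePreserving_eval (fun x => (K x).toMeasure) x

lemma advProb_mechanismParty (K : (Fin ℓ → Z) → PMF O) (A : Adversary) (x : Fin ℓ → Z)
    {T : Set A.Out} (hT : MeasurableSet T) :
    (mechanismParty K).advProb 1 A x T =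
      ∑ o, (K x o).toReal * A.law.real {a | A.output a [encode o] ∈ T} := by
  have measurableSet_output : MeasurableSet {s : O × A.Coins | A.output s.2 [encode s.1] ∈ T} :=
    measurable_from_prod_countable_right (f := fun s : O × A.Coins => A.output s.2 [encode s.1])
      (fun o => A.measurable_output [encode o]) hT
  have preserving := (measurePreserving_mechanismParty K x).prod (MeasurePreserving.id A.law)
  calc (mechanismParty K).advProb 1 A x T
      = ((K x).toMeasure.prod A.law).real {s | A.output s.2 [encode s.1] ∈ T} :=
        preserving.measureReal_preimage measurableSet_output.nullMeasurableSet
    _ = _ := by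
        rw [measureReal_prod_eq_integral _ _ measurableSet_output, PMF.integral_eq_sum]
        rfl

lemma advProb_mechanismParty_le {K : (Fin ℓ → Z) → PMF O} {C : ℝ} {x x' : Fin ℓ → Z}
    (h : ∀ o, (K x o).toReal ≤ C * (K x' o).toReal) (A : Adversary) {T : Set A.Out}
    (hT : MeasurableSet T) :
    (mechanismParty K).advProb 1 A x T ≤ C * (mechanismParty K).advProb 1 A x' T := by
  rw [advProb_mechanismParty K A x hT, advProb_mechanismParty K A x' hT, Finset.mul_sum]
  refine Finset.sum_le_sum fun o _ => ?_
  rw [← mul_assoc]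
  gcongr
  exact h o

end Mechanism

section ExponentialMechanism

variable {I O : Type} [Fintype O] [Nonempty O]

/-- The exponential mechanism at rate `r`: on input `x` it selects `o` with probability proportional
to `exp (-(r * L x o))`. -/
noncomputable def expMechanism (r : ℝ) (L : I → O → ℝ) (x : I) : PMF O :=
  pmfOfReal (fun o => Real.exp (-(r * L x o)) / ∑ o', Real.exp (-(r * L x o')))
    (fun o => by positivity) (by
      rw [← Finset.sum_div, div_self]
      exact (Finset.sum_pos (fun o _ => Real.exp_pos _) Finset.univ_nonempty).ne')

lemma toReal_expMechanism (r : ℝ) (L : I → O → ℝ) (x : I) (o : O) :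
    (expMechanism r L x o).toReal =
      Real.exp (-(r * L x o)) / ∑ o', Real.exp (-(r * L x o')) :=
  toReal_pmfOfReal _ _ o

lemma toReal_expMechanism_le_exp_mul {r ε : ℝ} {L : I → O → ℝ} {x x' : I}
    (h : ∀ o, |r * L x o - r * L x' o| ≤ ε / 2) (o : O) :
    (expMechanism r L x o).toReal ≤ Real.exp ε * (expMechanism r L x' o).toReal := by
  have sum_pos (x : I) : 0 < ∑ o, Real.exp (-(r * L x o)) :=
    Finset.sum_pos (fun o _ => Real.exp_pos _) Finset.univ_nonempty
  have weight_le (o : O) :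
      Real.exp (-(r * L x o)) ≤ Real.exp (ε / 2) * Real.exp (-(r * L x' o)) := by
    rw [← Real.exp_add, Real.exp_le_exp]
    linarith [(abs_le.1 (h o)).1]
  have sum_le : ∑ o, Real.exp (-(r * L x' o)) ≤
      Real.exp (ε / 2) * ∑ o, Real.exp (-(r * L x o)) := by
    rw [Finset.mul_sum]
    refine Finset.sum_le_sum fun o _ => ?_
    rw [← Real.exp_add, Real.exp_le_exp]
    linarith [(abs_le.1 (h o)).2]
  rw [toReal_expMechanism, toReal_expMechanism, mul_div_assoc',
    div_le_div_iff₀ (sum_pos x) (sum_pos x')]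
  calc Real.exp (-(r * L x o)) * ∑ o', Real.exp (-(r * L x' o'))
      ≤ (Real.exp (ε / 2) * Real.exp (-(r * L x' o))) *
          (Real.exp (ε / 2) * ∑ o', Real.exp (-(r * L x o'))) :=
        mul_le_mul (weight_le o) sum_le (sum_pos x').le (by positivity)
    _ = Real.exp ε * Real.exp (-(r * L x' o)) * ∑ o', Real.exp (-(r * L x o')) := by
        rw [← add_halves ε, Real.exp_add, add_halves]
        ring

lemma expMechanism_real_lt_le [MeasurableSpace O] [MeasurableSingletonClass O] {r : ℝ}
    (hr : 0 ≤ r) (L : I → O → ℝ) (x : I) (o₀ : O) (s : ℝ) :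
    (expMechanism r L x).toMeasure.real {o | L x o₀ + s < L x o} ≤
      Fintype.card O * Real.exp (-(r * s)) := by
  refine toMeasure_real_le_card_mul _ (Real.exp_pos _).le fun o ho => ?_
  rw [toReal_expMechanism]
  calc Real.exp (-(r * L x o)) / ∑ o', Real.exp (-(r * L x o'))
      ≤ Real.exp (-(r * L x o)) / Real.exp (-(r * L x o₀)) := by
        gcongr
        exact Finset.single_le_sum (f := fun o' => Real.exp (-(r * L x o')))
          (fun o' _ => (Real.exp_pos _).le) (Finset.mem_univ o₀)
    _ = Real.exp (-(r * (L x o - L x o₀))) := by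
        rw [← Real.exp_sub]
        ring_nf
    _ ≤ Real.exp (-(r * s)) := by
        gcongr
        exact (lt_sub_iff_add_lt'.2 ho).le

end ExponentialMechanism

/-! ## The curator -/

section Curator

variable {b c m J : ℕ}

lemma abs_sampleCount_sub_le_one_of_neighboring {Z : Type} {S S' : Fin m → Z}
    (h : Neighboring S S') (E : Set Z) : |sampleCount S E - sampleCount S' E| ≤ 1 := by
  obtain ⟨i, same⟩ := h
  rw [sampleCount_eq_sum_indicator, sampleCount_eq_sum_indicator, ← Finset.sum_sub_distrib,
    Finset.sum_eq_single i (fun j _ hj => by rw [same j hj, sub_self]) (by simp)]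
  by_cases hS : S i ∈ E <;> by_cases hS' : S' i ∈ E <;> simp [hS, hS']

lemma abs_inf'_sub_inf'_le {T : Type*} {s : Finset T} (hs : s.Nonempty) {f g : T → ℝ} {C : ℝ}
    (h : ∀ t ∈ s, |f t - g t| ≤ C) : |s.inf' hs f - s.inf' hs g| ≤ C := by
  rw [abs_sub_le_iff, sub_le_comm, sub_le_comm (a := s.inf' hs g), Finset.le_inf'_iff,
    Finset.le_inf'_iff]
  constructor <;> intro t ht
  · linarith [Finset.inf'_le f ht, (abs_le.1 (h t ht)).2]
  · linarith [Finset.inf'_le g ht, (abs_le.1 (h t ht)).1]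

/-- The loss of a parity and a quantile: the best trade-off, over all thresholds, between the number
of errors on the labeled sample `S` and the distance to the quantile. The curator selects a quantile
instead of a threshold because there are too many thresholds to choose from privately. -/
noncomputable def curatorLoss (S : Fin m → (Bits c × Bits b) × Bool) (o : Bits c × Fin (J + 1)) :
    ℝ :=
  Finset.univ.inf' Finset.univ_nonempty fun t : Bits b =>
    sampleCount S {z | concept o.1 t z.1 ≠ z.2} +
      |sampleCount S {z | z.1.2.val < t.val} - m * ((o.2 : ℕ) / J)|

lemma abs_curatorLoss_sub_le {S S' : Fin m → (Bits c × Bits b) × Bool} (h : Neighboring S S')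
    (o : Bits c × Fin (J + 1)) : |curatorLoss S o - curatorLoss S' o| ≤ 2 := by
  refine abs_inf'_sub_inf'_le _ fun t _ => ?_
  have errors := abs_sampleCount_sub_le_one_of_neighboring h {z | concept o.1 t z.1 ≠ z.2}
  have below := abs_sampleCount_sub_le_one_of_neighboring h {z | z.1.2.val < t.val}
  rw [add_sub_add_comm]
  refine (abs_add_le _ _).trans ((add_le_add errors ?_).trans_eq one_add_one_eq_two)
  refine (abs_abs_sub_abs_le_abs_sub _ _).trans ?_
  rwa [sub_sub_sub_cancel_right]

/-- The sets on which the sample of the curator should be representative: `none` stands for the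
examples below a threshold, `some k` for the errors of the hypotheses with parity `k`. -/
def testSet (f : Bits c × Bits b → Bool) : Option (Bits c) → Bits b → Set (Bits c × Bits b)
  | none, t => {z | z.2.val < t.val}
  | some k, t => {z | concept k t z ≠ f z}

open scoped symmDiff in
lemma testSet_symmDiff_subset (f : Bits c × Bits b → Bool) (a : Option (Bits c)) (s t : Bits b) :
    testSet f a s ∆ testSet f a t ⊆ {z | z.2.val < s.val} ∆ {z | z.2.val < t.val} := by
  rcases a with _ | k
  · rfl
  · intro z hz
    contrapose! hz
    have same_side : z.2.val < s.val ↔ z.2.val < t.val := by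
      simpa only [Set.mem_symmDiff, ← xor_def, Set.mem_ofPred_eq, xor_iff_not_iff, not_not] using hz
    have same_value : concept k s z = concept k t z := by
      simp only [concept, thr, ← not_lt, same_side]
    simp [testSet, Set.mem_symmDiff, same_value]

lemma sampleCount_le {Z : Type} (S : Fin m → Z) (E : Set Z) : sampleCount S E ≤ m := by
  refine (measureReal_mono (Set.subset_univ _)).trans_eq ?_
  simp [measureReal_def]

lemma exists_abs_sub_div_le (hJ : 0 < J) {x : ℝ} (hx : 0 ≤ x) (hx_one : x ≤ 1) :
    ∃ i : Fin (J + 1), |x - (i : ℕ) / J| ≤ 1 / J := by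
  have hJ' : (0 : ℝ) < J := by exact_mod_cast hJ
  have floor_div_le : ⌊x * J⌋₊ / J ≤ x := (div_le_iff₀ hJ').2 (Nat.floor_le (by positivity))
  have le_floor_div : x ≤ (⌊x * J⌋₊ + 1) / J := (le_div_iff₀ hJ').2 (Nat.lt_floor_add_one _).le
  rw [add_div] at le_floor_div
  refine ⟨⟨⌊x * J⌋₊, Nat.lt_succ_iff.2 (Nat.floor_le_of_le (mul_le_of_le_one_left hJ'.le hx_one))⟩,
    ?_⟩
  rw [abs_of_nonneg (sub_nonneg.2 floor_div_le)]
  exact sub_le_iff_le_add'.2 le_floor_div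

lemma exists_curatorLoss_le (hJ : 0 < J) (k : Bits c) (t : Bits b) (S : Fin m → Bits c × Bits b) :
    ∃ o : Bits c × Fin (J + 1),
      curatorLoss (fun j => (S j, concept k t (S j))) o ≤ m * (1 / J) := by
  set B : ℝ := sampleCount S {z | z.2.val < t.val}
  have B_nonneg : 0 ≤ B := measureReal_nonneg
  have B_le : B ≤ m := sampleCount_le S _
  obtain ⟨i, hi⟩ := exists_abs_sub_div_le hJ (div_nonneg B_nonneg m.cast_nonneg)
    (div_le_one_of_le₀ B_le m.cast_nonneg)
  have eq_mul : m * (B / m) = B := mul_div_cancel_of_imp' fun h => le_antisymm (h ▸ B_le) B_nonneg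
  have no_errors : sampleCount (fun j => (S j, concept k t (S j)))
      {z | concept k t z.1 ≠ z.2} = 0 := by
    simp [sampleCount]
  refine ⟨(k, i), (Finset.inf'_le _ (Finset.mem_univ t)).trans ?_⟩
  calc sampleCount (fun j => (S j, concept k t (S j))) {z | concept k t z.1 ≠ z.2} +
        |B - m * ((i : ℕ) / J)|
      = m * |B / m - (i : ℕ) / J| := by
        rw [no_errors, zero_add, ← abs_of_nonneg (m.cast_nonneg (α := ℝ)), ← abs_mul,
          abs_of_nonneg (m.cast_nonneg (α := ℝ)), mul_sub, eq_mul]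
    _ ≤ m * (1 / J) := by gcongr

lemma expMechanism_curatorLoss_real_lt_le (hJ : 0 < J) {r : ℝ} (hr : 0 ≤ r) (k : Bits c)
    (t : Bits b) (S : Fin m → Bits c × Bits b) :
    (expMechanism r (curatorLoss (J := J)) fun j => (S j, concept k t (S j))).toMeasure.real
        {o | m * (1 / J) + m * (1 / J) < curatorLoss (fun j => (S j, concept k t (S j))) o} ≤
      2 ^ c * ((J + 1) * Real.exp (-(r * (m * (1 / J))))) := by
  obtain ⟨o₀, ho₀⟩ := exists_curatorLoss_le hJ k t S
  refine (measureReal_mono fun o ho => ?_).trans ((expMechanism_real_lt_le hr curatorLoss _ o₀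
    (m * (1 / J))).trans_eq ?_)
  · exact (add_le_add_left ho₀ _).trans_lt ho
  · simp [mul_assoc]

end Curator

/-! ## The local agents -/

section Agent

variable {b : ℕ}

/-- The initial segment of `y` of length `j + 1`, padded with zeros. -/
def prefixThrough (j : Fin b) (y : Bits b) : Bits b := fun i => if i ≤ j then y i else false

/-- The initial segment of `t` of length `j`, padded with zeros. -/
def prefixBefore (j : Fin b) (t : Bits b) : Bits b := fun i => if i < j then t i else false

lemma prefixThrough_eq_prefixBefore_iff {j : Fin b} {y t : Bits b} :
    prefixThrough j y = prefixBefore j t ↔ y j = false ∧ ∀ i < j, y i = t i := by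
  simp only [funext_iff, prefixThrough, prefixBefore]
  constructor
  · exact fun h => ⟨by simpa using h j, fun i hi => by simpa [hi, hi.le] using h i⟩
  · rintro ⟨at_j, before_j⟩ i
    rcases lt_trichotomy i j with hi | rfl | hi
    · simp [hi, hi.le, before_j i hi]
    · simp [at_j]
    · simp [hi.not_ge, hi.le.not_gt]

/-- Every `y` below `t` leaves the path to `t` at exactly one level. -/
lemma sum_prefix_indicator (y t : Bits b) :
    ∑ j, (if t j = true ∧ prefixThrough j y = prefixBefore j t then (1 : ℝ) else 0) =
      if y.val < t.val then 1 else 0 := by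
  simp only [prefixThrough_eq_prefixBefore_iff, Bits.val_lt_val_iff_lex]
  split_ifs with h
  · obtain ⟨j, hj⟩ := h
    rw [Finset.sum_eq_single j (fun i _ hij => if_neg ?_) (by simp), if_pos hj]
    rintro ⟨t_i, y_i, agree⟩
    rcases lt_or_gt_of_ne hij with hlt | hgt
    · simpa [t_i, y_i] using hj.2.2 i hlt
    · simpa [hj.1, hj.2.1] using agree j hgt
  · exact Finset.sum_eq_zero fun j _ => if_neg fun hj => h ⟨j, hj⟩

lemma sum_sgn_apply_mul_sgn_apply {α : Type*} [Fintype α] [DecidableEq α] (u v : α) :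
    ∑ σ : α → Bool, sgn (σ u) * sgn (σ v) =
      if u = v then (Fintype.card (α → Bool) : ℝ) else 0 := by
  split_ifs with h
  · simp [h, sgn_mul_self]
  · have involutive : Function.Involutive fun σ : α → Bool => Function.update σ u (!σ u) :=
      fun σ => by simp
    have flip := Equiv.sum_comp involutive.toPerm fun σ : α → Bool => sgn (σ u) * sgn (σ v)
    simp only [Function.Involutive.coe_toPerm, Function.update_self, ne_eq, Ne.symm h,
      not_false_eq_true, Function.update_of_ne, sgn_not, neg_mul, Finset.sum_neg_distrib] at flip
    linarith

/-- The messages of the agents: a level, a sign for every initial segment, and a noisy sign. -/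
abbrev AgentMsg (b : ℕ) : Type := Fin b × (Bits b → Bool) × Bool

lemma sum_agentMsg (g : AgentMsg b → ℝ) : ∑ o, g o = ∑ j, ∑ σ, ∑ a, g (j, σ, a) := by
  simp only [Fintype.sum_prod_type]

/-- The bound `b (e ^ ε + 1) / (e ^ ε - 1)` on the estimates from the messages of the agents: only
one of the `b` levels is reported, and with noise. -/
noncomputable def estimatorScale (b : ℕ) (ε : ℝ) : ℝ :=
  b * ((Real.exp ε + 1) / (Real.exp ε - 1))

lemma estimatorScale_nonneg {ε : ℝ} (hε : 0 ≤ ε) : 0 ≤ estimatorScale b ε :=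
  mul_nonneg b.cast_nonneg
    (div_nonneg (by positivity) (sub_nonneg.2 (Real.one_le_exp hε)))

/-- The unbiased estimator, from the message of an agent with input `y`, of the event that `y` is
below the threshold `t`. -/
noncomputable def belowEstimator (ε : ℝ) (t : Bits b) (o : AgentMsg b) : ℝ :=
  if t o.1 = true then estimatorScale b ε * (sgn o.2.2 * sgn (o.2.1 (prefixBefore o.1 t))) else 0

lemma abs_belowEstimator_le {ε : ℝ} (hε : 0 ≤ ε) (t : Bits b) (o : AgentMsg b) :
    |belowEstimator ε t o| ≤ estimatorScale b ε := by
  unfold belowEstimator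
  split_ifs
  · rw [abs_mul, abs_mul, abs_sgn, abs_sgn, abs_of_nonneg (estimatorScale_nonneg hε), mul_one,
      mul_one]
  · simpa using estimatorScale_nonneg hε

variable [NeZero b]

/-- The agent with input `y` picks a random level and random signs, and sends the sign of its
initial segment at that level with randomized response. -/
noncomputable def agentMechanism (ε : ℝ) (y : Bits b) : PMF (AgentMsg b) :=
  pmfOfReal
    (fun o => (if o.2.2 = o.2.1 (prefixThrough o.1 y) then Real.exp ε else 1) /
      ((Real.exp ε + 1) * (b * Fintype.card (Bits b → Bool))))
    (fun o => by split_ifs <;> positivity) (by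
      have hb : (b : ℝ) ≠ 0 := NeZero.ne _
      have response_sum (j : Fin b) (σ : Bits b → Bool) :
          ∑ a, (if a = σ (prefixThrough j y) then Real.exp ε else 1) = Real.exp ε + 1 := by
        cases σ (prefixThrough j y) <;> simp [add_comm]
      simp only [sum_agentMsg, ← Finset.sum_div, response_sum, Finset.sum_const, Finset.card_univ,
        nsmul_eq_mul, Fintype.card_fin]
      field_simp)

lemma toReal_agentMechanism (ε : ℝ) (y : Bits b) (o : AgentMsg b) :
    (agentMechanism ε y o).toReal =
      (if o.2.2 = o.2.1 (prefixThrough o.1 y) then Real.exp ε else 1) /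
        ((Real.exp ε + 1) * (b * Fintype.card (Bits b → Bool))) :=
  toReal_pmfOfReal _ _ o

lemma toReal_agentMechanism_le_exp_mul {ε : ℝ} (hε : 0 ≤ ε) (y y' : Bits b) (o : AgentMsg b) :
    (agentMechanism ε y o).toReal ≤ Real.exp ε * (agentMechanism ε y' o).toReal := by
  have one_le := Real.one_le_exp hε
  rw [toReal_agentMechanism, toReal_agentMechanism, ← mul_div_assoc]
  gcongr
  split_ifs <;> nlinarith

lemma sum_response_mul_belowEstimator {ε : ℝ} (hε : 0 < ε) {t : Bits b} {j : Fin b}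
    (hj : t j = true) (σ : Bits b → Bool) (y : Bits b) :
    ∑ a, (agentMechanism ε y (j, σ, a)).toReal * belowEstimator ε t (j, σ, a) =
      sgn (σ (prefixThrough j y)) * sgn (σ (prefixBefore j t)) /
        Fintype.card (Bits b → Bool) := by
  have hb : (b : ℝ) ≠ 0 := NeZero.ne _
  have exp_sub_one_ne : Real.exp ε - 1 ≠ 0 := (sub_pos.2 (Real.one_lt_exp_iff.2 hε)).ne'
  have response_bias (v : Bool) :
      ∑ a : Bool, (if a = v then Real.exp ε else 1) * sgn a = (Real.exp ε - 1) * sgn v := by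
    cases v <;> simp [sgn] <;> ring
  calc ∑ a, (agentMechanism ε y (j, σ, a)).toReal * belowEstimator ε t (j, σ, a)
      = (∑ a : Bool, (if a = σ (prefixThrough j y) then Real.exp ε else 1) * sgn a) *
          (sgn (σ (prefixBefore j t)) /
            ((Real.exp ε - 1) * Fintype.card (Bits b → Bool))) := by
        rw [Finset.sum_mul]
        refine Finset.sum_congr rfl fun a _ => ?_
        simp only [toReal_agentMechanism, belowEstimator, estimatorScale, hj, if_true]
        field_simp
    _ = sgn (σ (prefixThrough j y)) * sgn (σ (prefixBefore j t)) /
          Fintype.card (Bits b → Bool) := by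
        rw [response_bias]
        field_simp

lemma integral_belowEstimator {ε : ℝ} (hε : 0 < ε) (t y : Bits b) :
    ∫ o, belowEstimator ε t o ∂(agentMechanism ε y).toMeasure =
      if y.val < t.val then 1 else 0 := by
  rw [PMF.integral_eq_sum, ← sum_prefix_indicator]
  simp only [smul_eq_mul, sum_agentMsg]
  refine Finset.sum_congr rfl fun j _ => ?_
  by_cases hj : t j = true
  · simp only [sum_response_mul_belowEstimator hε hj, ← Finset.sum_div,
      sum_sgn_apply_mul_sgn_apply, hj, true_and]
    split_ifs <;> simp
  · simp [belowEstimator, hj]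

lemma pi_agentMechanism_real_exists_le {n : ℕ} {ε : ℝ} (hε : 0 < ε) (y : Fin n → Bits b) {δ : ℝ}
    (hδ : 0 ≤ δ) :
    (Measure.pi fun i => (agentMechanism ε (y i)).toMeasure).real
        {msgs | ∃ t, n * δ ≤ |∑ i, belowEstimator ε t (msgs i) -
          sampleCount y {u | u.val < t.val}|} ≤
      2 ^ b * (2 * Real.exp (-(n * δ ^ 2 / (2 * estimatorScale b ε ^ 2)))) := by
  have bound := measureReal_exists_le_abs_sum_sub_integral_le
    (fun i => (agentMechanism ε (y i)).toMeasure) Finset.univ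
    (f := fun t _ => belowEstimator ε t) (fun _ _ => .of_discrete)
    (fun t _ _ o => abs_belowEstimator_le hε.le t o) hδ
  simpa [integral_belowEstimator hε, sampleCount_eq_sum_indicator, Set.indicator_apply] using bound

end Agent

/-! ## The referee -/

section Referee

open scoped symmDiff

variable {b c m n J : ℕ} (D : Measure (Bits c × Bits b)) [IsFiniteMeasure D]

/-- The probability of an example below the threshold `t`, a quantile function of `D`. -/
noncomputable def belowProb {b c : ℕ} (D : Measure (Bits c × Bits b)) (t : Bits b) : ℝ :=
  D.real {z | z.2.val < t.val}

lemma measureReal_symmDiff_below (s t : Bits b) :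
    D.real ({z | z.2.val < s.val} ∆ {z | z.2.val < t.val}) = |belowProb D s - belowProb D t| := by
  wlog h : s.val ≤ t.val generalizing s t
  · rw [symmDiff_comm, abs_sub_comm]
    exact this t s (le_of_not_ge h)
  have subset : {z : Bits c × Bits b | z.2.val < s.val} ⊆ {z | z.2.val < t.val} :=
    fun z hz => lt_of_lt_of_le hz h
  rw [symmDiff_of_le subset, measureReal_sdiff subset .of_discrete, abs_sub_comm]
  exact (abs_of_nonneg (sub_nonneg.2 (measureReal_mono subset))).symm

lemma genError_concept_le (f : Bits c × Bits b → Bool) (k : Bits c) (s t : Bits b) :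
    genError D f (concept k s) ≤
      genError D f (concept k t) + |belowProb D s - belowProb D t| := by
  have close := abs_measureReal_sub_le_of_symmDiff_subset D (testSet_symmDiff_subset f (some k) s t)
  rw [measureReal_symmDiff_below] at close
  exact sub_le_iff_le_add'.1 ((le_abs_self _).trans close)

/-- A threshold for which the estimate from the messages of the agents is closest to the
quantile `q`. -/
noncomputable def quantileThreshold (ε q : ℝ) (msgs : Fin n → AgentMsg b) : Bits b :=
  (Finite.exists_min fun t => |∑ i, belowEstimator ε t (msgs i) - n * q|).choose

lemma abs_sum_belowEstimator_quantileThreshold_sub_le (ε q : ℝ) (msgs : Fin n → AgentMsg b)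
    (t : Bits b) :
    |∑ i, belowEstimator ε (quantileThreshold ε q msgs) (msgs i) - n * q| ≤
      |∑ i, belowEstimator ε t (msgs i) - n * q| :=
  (Finite.exists_min fun t => |∑ i, belowEstimator ε t (msgs i) - n * q|).choose_spec t

/-- The hypothesis that the referee derives from the selection of the curator and the messages of
the agents. -/
noncomputable def hypothesis (ε : ℝ) (o : Bits c × Fin (J + 1)) (msgs : Fin n → AgentMsg b) :
    Bits c × Bits b → Bool :=
  concept o.1 (quantileThreshold ε ((o.2 : ℕ) / J) msgs)

omit [IsFiniteMeasure D] in
lemma exists_genError_add_le_of_curatorLoss_le (hm : 0 < m) {f : Bits c × Bits b → Bool}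
    {S : Fin m → Bits c × Bits b} {o : Bits c × Fin (J + 1)} {δ η : ℝ}
    (hdev : ∀ a t, deviation D S (testSet f a t) ≤ m * δ)
    (hloss : curatorLoss (fun j => (S j, f (S j))) o ≤ m * η) :
    ∃ t, genError D f (concept o.1 t) + |belowProb D t - (o.2 : ℕ) / J| ≤ 2 * δ + η := by
  obtain ⟨t, -, ht⟩ := Finset.exists_mem_eq_inf' (Finset.univ_nonempty (α := Bits b))
    fun t => sampleCount S (testSet f (some o.1) t) +
      |sampleCount S (testSet f none t) - m * ((o.2 : ℕ) / J)|
  have loss_eq : curatorLoss (fun j => (S j, f (S j))) o =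
      sampleCount S (testSet f (some o.1) t) +
        |sampleCount S (testSet f none t) - m * ((o.2 : ℕ) / J)| := by
    rw [← ht]
    simp only [curatorLoss, sampleCount, testSet]
    rfl
  have errors_le := (abs_le.1 (hdev (some o.1) t)).1
  have quantile_le := abs_sub_le (m * belowProb D t) (sampleCount S (testSet f none t))
    (m * ((o.2 : ℕ) / J))
  rw [abs_sub_comm (m * belowProb D t) (sampleCount _ _), ← mul_sub, abs_mul,
    Nat.abs_cast] at quantile_le
  have below_le : |sampleCount S (testSet f none t) - m * belowProb D t| ≤ m * δ := hdev none t
  refine ⟨t, le_of_mul_le_mul_left ?_ (Nat.cast_pos.2 hm : (0 : ℝ) < m)⟩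
  change -(m * δ) ≤ sampleCount S (testSet f (some o.1) t) - m * genError D f (concept o.1 t)
    at errors_le
  rw [loss_eq] at hloss
  linarith

lemma genError_hypothesis_le (hn : 0 < n) {ε θ : ℝ} {msgs : Fin n → AgentMsg b}
    (hest : ∀ t, |∑ i, belowEstimator ε t (msgs i) - n * belowProb D t| ≤ n * θ)
    (f : Bits c × Bits b → Bool) (o : Bits c × Fin (J + 1)) (t : Bits b) :
    genError D f (hypothesis ε o msgs) ≤
      genError D f (concept o.1 t) + 2 * |belowProb D t - (o.2 : ℕ) / J| + 2 * θ := by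
  set q : ℝ := (o.2 : ℕ) / J
  set s := quantileThreshold ε q msgs
  have quantile_s_le : |belowProb D s - q| ≤ |belowProb D t - q| + 2 * θ := by
    refine le_of_mul_le_mul_left ?_ (Nat.cast_pos.2 hn : (0 : ℝ) < n)
    have scale (u : Bits b) : n * |belowProb D u - q| = |n * belowProb D u - n * q| := by
      rw [← mul_sub, abs_mul, Nat.abs_cast]
    have to_s := abs_sub_le (n * belowProb D s) (∑ i, belowEstimator ε s (msgs i)) (n * q)
    rw [abs_sub_comm (n * belowProb D s) (∑ i, _)] at to_s
    have from_t := abs_sub_le (∑ i, belowEstimator ε t (msgs i)) (n * belowProb D t) (n * q)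
    rw [← scale] at to_s from_t
    linarith [abs_sum_belowEstimator_quantileThreshold_sub_le ε q msgs t, hest s, hest t]
  have near := abs_sub_le (belowProb D s) q (belowProb D t)
  rw [abs_sub_comm q] at near
  calc genError D f (concept o.1 s)
      ≤ genError D f (concept o.1 t) + |belowProb D s - belowProb D t| :=
        genError_concept_le D f o.1 s t
    _ ≤ genError D f (concept o.1 t) + 2 * |belowProb D t - q| + 2 * θ := by linarith

lemma genError_hypothesis_le_of_representative (hm : 0 < m) (hn : 0 < n) {ε : ℝ}
    {f : Bits c × Bits b → Bool} {S : Fin m → Bits c × Bits b} {S' : Fin n → Bits c × Bits b}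
    {o : Bits c × Fin (J + 1)} {msgs : Fin n → AgentMsg b}
    (hS : ∀ a t, deviation D S (testSet f a t) ≤ m * (4 * (1 / J)))
    (hS' : ∀ t, deviation D S' (testSet f none t) ≤ n * (1 / J))
    (hloss : curatorLoss (fun j => (S j, f (S j))) o ≤ m * (1 / J) + m * (1 / J))
    (hnoise : ∀ t, |∑ i, belowEstimator ε t (msgs i) - sampleCount S' (testSet f none t)| ≤
      n * (1 / J)) :
    genError D f (hypothesis ε o msgs) ≤ 24 * (1 / J) := by
  obtain ⟨t, ht⟩ := exists_genError_add_le_of_curatorLoss_le D (η := 2 * (1 / J)) hm hS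
    (hloss.trans_eq (by ring))
  have estimates_accurate (t : Bits b) :
      |∑ i, belowEstimator ε t (msgs i) - n * belowProb D t| ≤ n * (2 * (1 / J)) :=
    calc |∑ i, belowEstimator ε t (msgs i) - n * belowProb D t|
        ≤ |∑ i, belowEstimator ε t (msgs i) - sampleCount S' (testSet f none t)| +
            deviation D S' (testSet f none t) := abs_sub_le _ _ _
      _ ≤ n * (1 / J) + n * (1 / J) := add_le_add (hnoise t) (hS' t)
      _ = n * (2 * (1 / J)) := by ring
  have genError_nonneg : 0 ≤ genError D f (concept o.1 t) := measureReal_nonneg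
  linarith [genError_hypothesis_le D hn estimates_accurate f o t]

end Referee

/-! ## The learner in the hybrid model -/

lemma measurePreserving_pi_some {ι : Type*} [Fintype ι] {Ω : Option ι → Type*}
    [∀ i, MeasurableSpace (Ω i)] (μ : (i : Option ι) → Measure (Ω i))
    [∀ i, IsProbabilityMeasure (μ i)] :
    MeasurePreserving (fun (ω : (i : Option ι) → Ω i) i => ω (some i)) (Measure.pi μ)
      (Measure.pi fun i => μ (some i)) := by
  have equiv_preserving := (MeasurePreserving.mk (by fun_prop)
    (Measure.pi_map_piOptionEquivProd μ)).symm (MeasurableEquiv.piOptionEquivProd Ω).symm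
  exact measurePreserving_fst.comp equiv_preserving

lemma measureReal_prod_le_compl_add {α β : Type*} [MeasurableSpace α] [MeasurableSpace β]
    (μ : Measure α) (ν : Measure β) [IsProbabilityMeasure μ] [IsProbabilityMeasure ν]
    {G : Set α} (hG : MeasurableSet G) {E : Set (α × β)} (hE : MeasurableSet E) {C : ℝ}
    (hC : 0 ≤ C) (h : ∀ x ∈ G, ν.real (Prod.mk x ⁻¹' E) ≤ C) :
    (μ.prod ν).real E ≤ μ.real Gᶜ + C := by
  have subset : E ⊆ (Prod.fst ⁻¹' Gᶜ) ∪ (E ∩ Prod.fst ⁻¹' G) := fun s hs =>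
    (em (s.1 ∈ G)).symm.imp id fun hG => ⟨hs, hG⟩
  refine (measureReal_mono subset).trans ((measureReal_union_le _ _).trans (add_le_add ?_ ?_))
  · exact (measurePreserving_fst.measureReal_preimage hG.compl.nullMeasurableSet).le
  · refine measureReal_prod_le_of_forall μ ν (hE.inter (measurable_fst hG)) fun x => ?_
    by_cases hx : x ∈ G
    · exact (measureReal_mono fun ω hω => hω.1).trans (h x hx)
    · simpa [Set.preimage_inter, ← Set.preimage_comp, Function.comp_def, hx] using hC

namespace Protocol

variable {ι : Type} {ℓ : ι → ℕ} {X : Type} [MeasurableSpace X] [Countable X]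
  [MeasurableSingletonClass X]

lemma measurableSet_lt_genError [Finite ι] {P : Protocol ι ℓ (X × Bool) (X → Bool)} (D : Measure X)
    [IsFiniteMeasure D] (f : X → Bool) (α : ℝ) :
    MeasurableSet {s : ((i : ι) → Fin (ℓ i) → X) × ((i : ι) → (P.party i).Coins) × P.RefCoins |
      α < genError D f (P.outcome (fun i j => (s.1 i j, f (s.1 i j))) s.2.1 s.2.2)} := by
  have measurable_label :
      Measurable fun (x : (i : ι) → Fin (ℓ i) → X) i j => (x i j, f (x i j)) :=
    Measurable.of_discrete
  have measurable_error := P.measurable_outcome.comp (measurable_label.prodMap measurable_id)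
    (measurableSet_genError_le D f α)
  simp only [← not_le]
  exact measurable_error.compl

lemma isPACLearner_of_typical_data [Fintype ι] {P : Protocol ι ℓ (X × Bool) (X → Bool)}
    {C : Set (X → Bool)} {α β₁ β₂ : ℝ} (hβ₂ : 0 ≤ β₂)
    (h : ∀ f ∈ C, ∀ D : Measure X, IsProbabilityMeasure D →
      ∃ G : Set ((i : ι) → Fin (ℓ i) → X),
        (Measure.pi fun i : ι => Measure.pi fun _ : Fin (ℓ i) => D).real Gᶜ ≤ β₁ ∧
        ∀ x ∈ G, P.coinLaw.real
          {s | α < genError D f (P.outcome (fun i j => (x i j, f (x i j))) s.1 s.2)} ≤ β₂) :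
    P.IsPACLearner C α (β₁ + β₂) := by
  intro f hf D _
  obtain ⟨G, hG, hGβ₂⟩ := h f hf D ‹_›
  have failure_le := (measureReal_prod_le_compl_add (Measure.pi fun i : ι =>
    Measure.pi fun _ : Fin (ℓ i) => D) P.coinLaw MeasurableSet.of_discrete
    (measurableSet_lt_genError (P := P) D f α) hβ₂ hGβ₂).trans (add_le_add hG le_rfl)
  rw [sub_le_iff_le_add, ← probReal_univ (μ := (Measure.pi fun i : ι =>
    Measure.pi fun _ : Fin (ℓ i) => D).prod P.coinLaw)]
  refine (measureReal_mono (fun s _ => ?_)).trans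
    ((measureReal_union_le _ _).trans (add_le_add le_rfl failure_le))
  exact le_or_gt (genError D f (P.outcome (fun i j => (s.1 i j, f (s.1 i j))) s.2.1 s.2.2)) α

end Protocol

/-- The joint inputs of the parties in the `(m, n)`-hybrid model. -/
abbrev HybridData (m n : ℕ) (Z : Type) : Type :=
  (i : Option (Fin n)) → Fin (hybridSize m n i) → Z

section HybridData

variable {b c m n : ℕ}

/-- The data points of the curator. -/
def curatorSample (x : HybridData m n (Bits c × Bits b)) :
    Fin m → Bits c × Bits b :=
  x none

/-- The data points of the agents. -/
def agentSample (x : HybridData m n (Bits c × Bits b)) (i : Fin n) :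
    Bits c × Bits b :=
  x (some i) (0 : Fin 1)

variable (D : Measure (Bits c × Bits b)) [IsProbabilityMeasure D] (f : Bits c × Bits b → Bool)

lemma measurePreserving_curatorSample :
    MeasurePreserving curatorSample
      (Measure.pi fun i : Option (Fin n) => Measure.pi fun _ : Fin (hybridSize m n i) => D)
      (Measure.pi fun _ => D) :=
  measurePreserving_eval
    (fun i : Option (Fin n) => Measure.pi fun _ : Fin (hybridSize m n i) => D) none

lemma measurePreserving_agentSample :
    MeasurePreserving agentSample
      (Measure.pi fun i : Option (Fin n) => Measure.pi fun _ : Fin (hybridSize m n i) => D)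
      (Measure.pi fun _ => D) :=
  (measurePreserving_pi _ _ fun _ : Fin n => measurePreserving_eval (fun _ : Fin 1 => D) 0).comp
    (measurePreserving_pi_some fun i => Measure.pi fun _ : Fin (hybridSize m n i) => D)

/-- The test sets have about the same frequencies in the data as under `D`. The agents only have to
represent the thresholds, and the bound is smaller for them because it does not lose the factor of
the bracketing argument. -/
def Representative (J : ℕ)
    (x : HybridData m n (Bits c × Bits b)) : Prop :=
  (∀ a t, deviation D (curatorSample x) (testSet f a t) ≤ m * (4 * (1 / J))) ∧
    ∀ t, deviation D (agentSample x) (testSet f none t) ≤ n * (1 / J)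

lemma measureReal_not_representative_le {J : ℕ} (hJ : 0 < J) :
    (Measure.pi fun i : Option (Fin n) => Measure.pi fun _ : Fin (hybridSize m n i) => D).real
        {x | Representative D f J x}ᶜ ≤
      (2 ^ c + 2) * (J + 1) * (2 * Real.exp (-(m * (1 / J : ℝ) ^ 2 / 2))) +
        2 ^ b * (2 * Real.exp (-(n * (1 / J : ℝ) ^ 2 / 2))) := by
  have curator_bound := measureReal_exists_lt_deviation_le_of_symmDiff_subset (m := m) D Bits.val
    (fun z : Bits c × Bits b => z.2.val) (testSet_symmDiff_subset f) hJ
  have agents_bound := measureReal_exists_le_deviation_le (m := n) D (δ := 1 / J)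
    (fun t => MeasurableSet.of_discrete (s := testSet f none t)) (by positivity)
  rw [← (measurePreserving_curatorSample (n := n) D).measureReal_preimage
    MeasurableSet.of_discrete.nullMeasurableSet] at curator_bound
  rw [← (measurePreserving_agentSample (m := m) D).measureReal_preimage
    MeasurableSet.of_discrete.nullMeasurableSet] at agents_bound
  refine (measureReal_mono fun x hx => ?_).trans ((measureReal_union_le _ _).trans
    (add_le_add (curator_bound.trans_eq ?_) (agents_bound.trans_eq ?_)))
  · rw [Set.mem_compl_iff, Set.mem_ofPred_eq, Representative, not_and_or] at hx
    push Not at hx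
    exact hx.imp id fun ⟨t, ht⟩ => ⟨t, ht.le⟩
  · simp [add_assoc, one_add_one_eq_two]
  · simp

end HybridData

section HybridLearner

variable {b c m n : ℕ} [NeZero b]

/-- The parties of the hybrid learner: the curator selects a parity and a quantile, the agents
estimate all quantiles. -/
noncomputable def hybridParty (b c m n J : ℕ) [NeZero b] (ε : ℝ) :
    (i : Option (Fin n)) → Party (hybridSize m n i) ((Bits c × Bits b) × Bool)
  | none => mechanismParty (expMechanism (ε / 4)
      (curatorLoss : (Fin m → (Bits c × Bits b) × Bool) → Bits c × Fin (J + 1) → ℝ))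
  | some _ => mechanismParty fun x : Fin 1 → (Bits c × Bits b) × Bool =>
      agentMechanism ε (x 0).1.2

/-- The hybrid learner with privacy parameter `ε` and quantiles that are multiples of `1 / J`. -/
noncomputable def hybridLearner (b c m n J : ℕ) [NeZero b] (ε : ℝ) :
    HybridProtocol m n ((Bits c × Bits b) × Bool) (Bits c × Bits b → Bool) where
  rounds := 1
  party := hybridParty b c m n J ε
  RefCoins := Unit
  refLaw := Measure.dirac ()
  query _ _ _ := 0
  measurable_query _ _ := measurable_const
  output _ replies := match replies with
    | [] => fun _ => false
    | r :: _ => hypothesis (J := J) ε (Function.invFun encode (r none))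
        fun i => Function.invFun encode (r (some i))
  measurable_output _ := measurable_const

variable {J : ℕ} {ε : ℝ}

lemma hybridLearner_nonInteractive : (hybridLearner b c m n J ε).NonInteractive :=
  ⟨rfl, fun _ _ => rfl⟩

lemma hybridLearner_isDP (hε : 0 ≤ ε) : (hybridLearner b c m n J ε).IsDP ε := by
  intro i A x x' hx T hT
  rw [add_zero]
  match i with
  | none =>
    refine advProb_mechanismParty_le (toReal_expMechanism_le_exp_mul fun o => ?_) A hT
    rw [← mul_sub, abs_mul, abs_of_nonneg (by positivity)]
    calc ε / 4 * |curatorLoss x o - curatorLoss x' o| ≤ ε / 4 * 2 := by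
          gcongr
          exact abs_curatorLoss_sub_le hx o
      _ = ε / 2 := by ring
  | some _ =>
    exact advProb_mechanismParty_le
      (K := fun x : Fin 1 → (Bits c × Bits b) × Bool => agentMechanism ε (x 0).1.2)
      (toReal_agentMechanism_le_exp_mul hε _ _) A hT

/-- The parity and the quantile that the curator selects. Its coins prescribe a selection for every
input, and likewise for the agents below. -/
def curatorReply (x : HybridData m n ((Bits c × Bits b) × Bool))
    (ω : (i : Option (Fin n)) → (hybridParty b c m n J ε i).Coins) : Bits c × Fin (J + 1) :=
  (ω none : (Fin m → (Bits c × Bits b) × Bool) → Bits c × Fin (J + 1)) (x none)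

/-- The messages of the agents, before they are encoded. -/
def agentReplies (x : HybridData m n ((Bits c × Bits b) × Bool))
    (ω : (i : Option (Fin n)) → (hybridParty b c m n J ε i).Coins) (i : Fin n) : AgentMsg b :=
  (ω (some i) : (Fin 1 → (Bits c × Bits b) × Bool) → AgentMsg b) (x (some i))

lemma outcome_hybridLearner
    (x : HybridData m n ((Bits c × Bits b) × Bool))
    (ω : (i : Option (Fin n)) → ((hybridLearner b c m n J ε).party i).Coins)
    (ρ : (hybridLearner b c m n J ε).RefCoins) :
    (hybridLearner b c m n J ε).outcome x ω ρ =
      hypothesis ε (curatorReply x ω) (agentReplies x ω) := by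
  have decode {O : Type} [Fintype O] [Nonempty O] (o : O) :
      Function.invFun encode (encode o) = o := Function.leftInverse_invFun encode_injective o
  change hypothesis ε (Function.invFun encode (encode (curatorReply x ω)))
    (fun i => Function.invFun encode (encode (agentReplies x ω i))) = _
  simp only [decode]

variable (f : Bits c × Bits b → Bool)
  (x : HybridData m n (Bits c × Bits b))

lemma measurePreserving_curatorReply :
    MeasurePreserving (fun s => curatorReply (fun i j => (x i j, f (x i j))) s.1)
      (hybridLearner b c m n J ε).coinLaw
      (expMechanism (ε / 4) curatorLoss
        fun j => (curatorSample x j, f (curatorSample x j))).toMeasure :=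
  ((measurePreserving_mechanismParty _ fun j => (curatorSample x j, f (curatorSample x j))).comp
    (measurePreserving_eval (fun i => (hybridParty b c m n J ε i).law) none)).comp
      measurePreserving_fst

lemma measurePreserving_agentReplies :
    MeasurePreserving (fun s => agentReplies (fun i j => (x i j, f (x i j))) s.1)
      (hybridLearner b c m n J ε).coinLaw
      (Measure.pi fun i => (agentMechanism ε (agentSample x i).2).toMeasure) :=
  ((measurePreserving_pi _ _ fun i : Fin n => measurePreserving_mechanismParty _
      fun j => (x (some i) j, f (x (some i) j))).comp
    (measurePreserving_pi_some fun i => (hybridParty b c m n J ε i).law)).comp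
      measurePreserving_fst

lemma coinLaw_real_lt_curatorLoss_le (hJ : 0 < J) (hε : 0 ≤ ε) (k : Bits c) (t : Bits b) :
    (hybridLearner b c m n J ε).coinLaw.real
        {s | m * (1 / J) + m * (1 / J) <
          curatorLoss (fun j => (curatorSample x j, concept k t (curatorSample x j)))
            (curatorReply (fun i j => (x i j, concept k t (x i j))) s.1)} ≤
      2 ^ c * ((J + 1) * Real.exp (-(ε / 4 * (m * (1 / J))))) := by
  have bound := expMechanism_curatorLoss_real_lt_le hJ (by positivity : 0 ≤ ε / 4) k t
    (curatorSample x)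
  rwa [← (measurePreserving_curatorReply (concept k t) x).measureReal_preimage
    MeasurableSet.of_discrete.nullMeasurableSet] at bound

lemma coinLaw_real_noise_le (hε : 0 < ε) :
    (hybridLearner b c m n J ε).coinLaw.real
        {s | ∃ t, n * (1 / J : ℝ) ≤ |∑ i, belowEstimator ε t
          (agentReplies (fun i j => (x i j, f (x i j))) s.1 i) -
            sampleCount (agentSample x) (testSet f none t)|} ≤
      2 ^ b * (2 * Real.exp (-(n * (1 / J) ^ 2 / (2 * estimatorScale b ε ^ 2)))) := by
  have bound := pi_agentMechanism_real_exists_le hε (fun i => (agentSample x i).2)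
    (by positivity : (0 : ℝ) ≤ 1 / J)
  rwa [← (measurePreserving_agentReplies (J := J) f x).measureReal_preimage
    MeasurableSet.of_discrete.nullMeasurableSet] at bound

lemma coinLaw_real_lt_genError_le (hm : 0 < m) (hn : 0 < n) (hJ : 0 < J) (hε : 0 < ε)
    (D : Measure (Bits c × Bits b)) [IsProbabilityMeasure D] {k : Bits c} {t : Bits b}
    (hx : Representative D (concept k t) J x) :
    (hybridLearner b c m n J ε).coinLaw.real
        {s | 24 * (1 / J) < genError D (concept k t) ((hybridLearner b c m n J ε).outcome
          (fun i j => (x i j, concept k t (x i j))) s.1 s.2)} ≤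
      2 ^ c * ((J + 1) * Real.exp (-(ε / 4 * (m * (1 / J))))) +
        2 ^ b * (2 * Real.exp (-(n * (1 / J) ^ 2 / (2 * estimatorScale b ε ^ 2)))) := by
  refine (measureReal_mono fun s hs => ?_).trans ((measureReal_union_le _ _).trans
    (add_le_add (coinLaw_real_lt_curatorLoss_le x hJ hε.le k t)
      (coinLaw_real_noise_le (concept k t) x hε)))
  by_contra! accurate
  simp only [Set.mem_union, Set.mem_ofPred_eq, not_or, not_lt, not_exists, not_le] at accurate
  rw [Set.mem_ofPred_eq, outcome_hybridLearner] at hs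
  exact hs.not_ge <| genError_hypothesis_le_of_representative D hm hn hx.1 hx.2 accurate.1
    fun t => (accurate.2 t).le

theorem hybridLearner_isPACLearner (hm : 0 < m) (hn : 0 < n) (hJ : 0 < J) (hε : 0 < ε) :
    (hybridLearner b c m n J ε).IsPACLearner (ParityThresh b c) (24 * (1 / J))
      ((2 ^ c + 2) * (J + 1) * (2 * Real.exp (-(m * (1 / J : ℝ) ^ 2 / 2))) +
        2 ^ b * (2 * Real.exp (-(n * (1 / J : ℝ) ^ 2 / 2))) +
        (2 ^ c * ((J + 1) * Real.exp (-(ε / 4 * (m * (1 / J))))) +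
          2 ^ b * (2 * Real.exp (-(n * (1 / J) ^ 2 / (2 * estimatorScale b ε ^ 2)))))) := by
  refine Protocol.isPACLearner_of_typical_data (by positivity) ?_
  rintro _ ⟨k, t, rfl⟩ D _
  exact ⟨{x | Representative D (concept k t) J x}, measureReal_not_representative_le D _ hJ,
    fun x hx => coinLaw_real_lt_genError_le x hm hn hJ hε D hx⟩

end HybridLearner

section Accuracy

lemma Protocol.IsPACLearner.mono {ι : Type} [Fintype ι] {ℓ : ι → ℕ} {X : Type} [MeasurableSpace X]
    {P : Protocol ι ℓ (X × Bool) (X → Bool)} {C : Set (X → Bool)} {α α' β β' : ℝ}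
    (hα : α ≤ α') (hβ : β ≤ β') (hP : P.IsPACLearner C α β) :
    P.IsPACLearner C α' β' :=
  fun f hf D hD => (sub_le_sub_left hβ 1).trans
    ((hP f hf D hD).trans (measureReal_mono fun s hs => hs.trans hα))

lemma estimatorScale_le (b : ℕ) {ε : ℝ} (hε : 0 < ε) : estimatorScale b ε ≤ b * (1 + 2 / ε) := by
  have le_exp_sub_one : ε ≤ Real.exp ε - 1 := le_sub_iff_add_le.2 (Real.add_one_le_exp ε)
  have ratio : (Real.exp ε + 1) / (Real.exp ε - 1) = 1 + 2 / (Real.exp ε - 1) := by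
    rw [one_add_div (hε.trans_le le_exp_sub_one).ne']
    ring
  rw [estimatorScale, ratio]
  gcongr

lemma two_pow_mul_exp_neg_le {K E : ℝ} {q : ℕ} (hq : 1 ≤ q) (hK : K ≤ 2 ^ 10) (hE : 32 * q ≤ E) :
    2 ^ q * (K * Real.exp (-E)) ≤ 1 / 16 := by
  have two_le_exp_one : (2 : ℝ) ≤ Real.exp 1 := by linarith [Real.add_one_le_exp (1 : ℝ)]
  have le_exp : 2 ^ q * 2 ^ 10 * 16 ≤ Real.exp E :=
    calc (2 : ℝ) ^ q * 2 ^ 10 * 16 = 2 ^ (q + 14) := by ring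
      _ ≤ 2 ^ (32 * q) := pow_le_pow_right₀ one_le_two (by lia)
      _ ≤ Real.exp 1 ^ (32 * q) := by gcongr
      _ = Real.exp (32 * q) := by rw [← Real.exp_nat_mul]; push_cast; ring_nf
      _ ≤ Real.exp E := Real.exp_le_exp.2 hE
  rw [Real.exp_neg, ← mul_assoc, ← div_eq_mul_inv, div_le_div_iff₀ (Real.exp_pos E) (by norm_num)]
  nlinarith [pow_pos (two_pos : (0 : ℝ) < 2) q]

lemma le_div_estimatorScale_sq {b n : ℕ} [NeZero b] (hn : 2 ^ 30 * (b : ℝ) ^ 3 ≤ n) :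
    32 * b ≤ n * (1 / 128) ^ 2 / (2 * estimatorScale b (1 / 4) ^ 2) := by
  have b_pos : (0 : ℝ) < b := by exact_mod_cast NeZero.pos b
  have scale_pos : 0 < estimatorScale b (1 / 4) :=
    mul_pos b_pos (div_pos (by positivity) (sub_pos.2 (Real.one_lt_exp_iff.2 (by norm_num))))
  have scale_le : estimatorScale b (1 / 4) ≤ b * 9 :=
    (estimatorScale_le b (by norm_num)).trans_eq (by norm_num)
  calc (32 * b : ℝ) ≤ 2 ^ 30 * b ^ 3 * (1 / 128) ^ 2 / (2 * (b * 9) ^ 2) := by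
        rw [le_div_iff₀ (by positivity)]
        nlinarith [pow_pos b_pos 3]
    _ ≤ n * (1 / 128) ^ 2 / (2 * estimatorScale b (1 / 4) ^ 2) := by gcongr

theorem hybridLearner_isPrivateLearner {b c m n : ℕ} [NeZero b] (hc : 1 ≤ c)
    (hm : 2 ^ 20 * c ≤ m) (hn : 2 ^ 30 * b ^ 3 ≤ n) :
    (hybridLearner b c m n 128 (1 / 4)).IsPrivateLearner := by
  have hm' : (2 : ℝ) ^ 20 * c ≤ m := by exact_mod_cast hm
  have hn' : (2 : ℝ) ^ 30 * b ^ 3 ≤ n := by exact_mod_cast hn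
  have b_le_cube : (b : ℝ) ≤ b ^ 3 := by exact_mod_cast Nat.le_self_pow three_ne_zero b
  have curator_typical :
      ((2 : ℝ) ^ c + 2) * (128 + 1) * (2 * Real.exp (-(m * (1 / 128) ^ 2 / 2))) ≤ 1 / 16 := by
    have two_le : (2 : ℝ) ≤ 2 ^ c := le_self_pow₀ one_le_two (by lia)
    calc ((2 : ℝ) ^ c + 2) * (128 + 1) * (2 * Real.exp (-(m * (1 / 128) ^ 2 / 2)))
        ≤ (2 ^ c + 2 ^ c) * (128 + 1) * (2 * Real.exp (-(m * (1 / 128) ^ 2 / 2))) := by gcongr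
      _ = 2 ^ c * (516 * Real.exp (-(m * (1 / 128) ^ 2 / 2))) := by ring
      _ ≤ 1 / 16 := two_pow_mul_exp_neg_le hc (by norm_num) (by linarith)
  have agents_typical : (2 : ℝ) ^ b * (2 * Real.exp (-(n * (1 / 128) ^ 2 / 2))) ≤ 1 / 16 :=
    two_pow_mul_exp_neg_le NeZero.one_le (by norm_num) (by linarith)
  have good_selection :
      (2 : ℝ) ^ c * ((128 + 1) * Real.exp (-(1 / 4 / 4 * (m * (1 / 128))))) ≤ 1 / 16 :=
    two_pow_mul_exp_neg_le hc (by norm_num) (by linarith)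
  have good_estimates : (2 : ℝ) ^ b *
      (2 * Real.exp (-(n * (1 / 128) ^ 2 / (2 * estimatorScale b (1 / 4) ^ 2)))) ≤ 1 / 16 :=
    two_pow_mul_exp_neg_le NeZero.one_le (by norm_num) (le_div_estimatorScale_sq hn')
  have n_pos : 0 < n := (mul_pos (by norm_num) (pow_pos (NeZero.pos b) 3)).trans_le hn
  refine ⟨hybridLearner_isDP (by norm_num), (hybridLearner_isPACLearner (by lia) n_pos
    (by norm_num) (by norm_num)).mono (by norm_num) ?_⟩
  simp only [Nat.cast_ofNat]
  linarith

end Accuracy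

section Asymptotics

/-- The number `m` of samples of the curator in the hybrid model. -/
def curatorSize (c : ℕ) : ℕ := 2 ^ 20 * c

/-- The number `n` of agents in the hybrid model. The first summand suffices for the learner. The
constant of the second one, which dominates, has to be small: a local protocol with `2 ^ O(c)`
agents can learn. -/
noncomputable def agentCount (c : ℕ) : ℕ := 2 ^ 30 * c ^ 6 + ⌊(c : ℝ) ^ 6 * Real.logb 2 c / 2 ^ 12⌋₊

lemma isTheta_curatorSize :
    (fun c => (curatorSize c : ℝ)) =Θ[atTop] fun c : ℕ => (c : ℝ) := by
  simp only [curatorSize, Nat.cast_mul]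
  exact (isTheta_refl _ _).const_mul_left (by norm_num)

lemma pow_mul_logb_nonneg (c k : ℕ) : 0 ≤ (c : ℝ) ^ k * Real.logb 2 c :=
  mul_nonneg (by positivity) (div_nonneg (Real.log_natCast_nonneg c) (Real.log_nonneg one_le_two))

lemma le_agentCount {c : ℕ} (hc : 1 ≤ c) :
    (c : ℝ) ^ 6 * Real.logb 2 c / 2 ^ 12 ≤ agentCount c := by
  have one_le_pow : (1 : ℝ) ≤ (c : ℝ) ^ 6 := one_le_pow₀ (by exact_mod_cast hc)
  have lt_floor := Nat.lt_floor_add_one ((c : ℝ) ^ 6 * Real.logb 2 c / 2 ^ 12)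
  simp only [agentCount, Nat.cast_add, Nat.cast_mul, Nat.cast_pow, Nat.cast_ofNat]
  linarith

lemma eventually_agentCount_le :
    ∀ᶠ c : ℕ in atTop, (agentCount c : ℝ) ≤ (c : ℝ) ^ 6 * Real.logb 2 c / 2 ^ 11 := by
  have logb_atTop : Tendsto (fun c : ℕ => Real.logb 2 c) atTop atTop :=
    (Real.tendsto_logb_atTop one_lt_two).comp tendsto_natCast_atTop_atTop
  filter_upwards [logb_atTop.eventually_ge_atTop (2 ^ 42)] with c le_logb
  have floor_le := Nat.floor_le
    (div_nonneg (pow_mul_logb_nonneg c 6) (by norm_num : (0 : ℝ) ≤ 2 ^ 12))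
  have mul_le_mul_logb : (c : ℝ) ^ 6 * 2 ^ 42 ≤ (c : ℝ) ^ 6 * Real.logb 2 c := by gcongr
  simp only [agentCount, Nat.cast_add, Nat.cast_mul, Nat.cast_pow, Nat.cast_ofNat]
  linarith

lemma isTheta_agentCount :
    (fun c => (agentCount c : ℝ)) =Θ[atTop] fun c : ℕ => (c : ℝ) ^ 6 * Real.logb 2 c := by
  constructor
  · refine IsBigO.of_bound 1 ?_
    filter_upwards [eventually_agentCount_le] with c agentCount_le
    have growth_nonneg := pow_mul_logb_nonneg c 6
    rw [Real.norm_of_nonneg (Nat.cast_nonneg _), Real.norm_of_nonneg growth_nonneg]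
    linarith
  · refine IsBigO.of_bound (2 ^ 12) ?_
    filter_upwards [eventually_ge_atTop 1] with c hc
    rw [Real.norm_of_nonneg (pow_mul_logb_nonneg c 6), Real.norm_of_nonneg (Nat.cast_nonneg _)]
    linarith [le_agentCount hc]

lemma eventually_localExponent_le :
    ∀ᶠ c : ℕ in atTop, localExponent (agentCount c) ≤ (c : ℝ) / 4 := by
  filter_upwards [eventually_agentCount_le, eventually_ge_atTop 2] with c agentCount_le hc
  have logb_pos : 0 < Real.logb 2 c := Real.logb_pos one_lt_two (by exact_mod_cast hc)
  have pow_le_agentCount : (c : ℝ) ^ 6 ≤ agentCount c := by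
    exact_mod_cast (show c ^ 6 ≤ agentCount c by unfold agentCount; lia)
  have logb_le : 6 * Real.logb 2 c ≤ Real.logb 2 (agentCount c) :=
    calc 6 * Real.logb 2 c = Real.logb 2 ((c : ℝ) ^ 6) := by rw [Real.logb_pow]; norm_num
      _ ≤ Real.logb 2 (agentCount c) :=
        Real.logb_le_logb_of_le one_lt_two (by positivity) pow_le_agentCount
  have ratio_le : (agentCount c : ℝ) / Real.logb 2 (agentCount c) ≤ ((c : ℝ) / 4) ^ 6 := by
    rw [div_le_iff₀ (by linarith)]
    calc (agentCount c : ℝ) ≤ (c : ℝ) ^ 6 * Real.logb 2 c / 2 ^ 11 := agentCount_le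
      _ ≤ ((c : ℝ) / 4) ^ 6 * (6 * Real.logb 2 c) := by
        rw [div_pow]
        linarith [pow_mul_logb_nonneg c 6]
      _ ≤ ((c : ℝ) / 4) ^ 6 * Real.logb 2 (agentCount c) := by gcongr
  calc localExponent (agentCount c) ≤ (((c : ℝ) / 4) ^ 6) ^ (1 / 6 : ℝ) :=
        Real.rpow_le_rpow (div_nonneg (Nat.cast_nonneg _) (by linarith)) ratio_le (by norm_num)
    _ = (c : ℝ) / 4 := by
        rw [one_div]
        exact Real.pow_rpow_inv_natCast (by positivity) (by norm_num : (6 : ℕ) ≠ 0)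

lemma two_pow_lt_of_local_learner {b c N : ℕ} (hc : 8 ≤ c)
    (P : LocalProtocol N ((Bits c × Bits b) × Bool) (Bits c × Bits b → Bool))
    (hP : P.IsPrivateLearner) : (2 : ℝ) ^ ((c : ℝ) / 4) < N := by
  by_contra! hN
  have hc' : (8 : ℝ) ≤ c := by exact_mod_cast hc
  have exp_le : Real.exp (1 / 4) ≤ 2 := by
    linarith [Real.exp_bound_div_one_sub_of_interval (x := 1 / 4) (by norm_num) (by norm_num)]
  have sqrt_eq : √((2 : ℝ) ^ c) = 2 ^ ((c : ℝ) / 2) := by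
    rw [Real.sqrt_eq_rpow, ← Real.rpow_natCast, ← Real.rpow_mul two_pos.le, mul_one_div]
  have mul_sqrt_le : N * (√((2 : ℝ) ^ c) * (Real.exp (1 / 4) / 2)) ≤ 2 ^ c / 4 :=
    calc N * (√((2 : ℝ) ^ c) * (Real.exp (1 / 4) / 2))
        ≤ 2 ^ ((c : ℝ) / 4) * (2 ^ ((c : ℝ) / 2) * (2 / 2)) := by rw [sqrt_eq]; gcongr
      _ = 2 ^ ((c : ℝ) / 4 + (c : ℝ) / 2) := by rw [Real.rpow_add two_pos]; ring
      _ ≤ 2 ^ ((c : ℝ) - 2) := Real.rpow_le_rpow_of_exponent_le one_le_two (by linarith)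
      _ = 2 ^ c / 4 := by rw [Real.rpow_sub two_pos, Real.rpow_natCast]; norm_num
  have le_two_pow : (2 : ℝ) ^ 8 ≤ 2 ^ c := pow_le_pow_right₀ one_le_two hc
  linarith [local_lower_bound P (by norm_num) hP.1 hP.2]

lemma eventually_two_pow_localExponent_lt (b : ℕ → ℕ) :
    ∀ᶠ c in atTop, ∀ N : ℕ,
      ∀ P : LocalProtocol N ((Bits c × Bits (b c)) × Bool) (Bits c × Bits (b c) → Bool),
        P.IsPrivateLearner → (2 : ℝ) ^ localExponent (agentCount c) < N := by
  filter_upwards [eventually_localExponent_le, eventually_ge_atTop 8] with c exponent_le hc N P hP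
  exact (Real.rpow_le_rpow_of_exponent_le one_le_two exponent_le).trans_lt
    (two_pow_lt_of_local_learner hc P hP)

-- `exp (1 / 32)` per coordinate comes from group privacy on `b / 8` samples.
lemma exp_mul_rpow_lt {b : ℕ} (hb : 4 ≤ b) :
    Real.exp (b / 32) * ((3 / 2) ^ b * 2 ^ (1 / 4 * (b : ℝ))) < 3 / 4 * 2 ^ b := by
  have exp_lt : Real.exp (1 / 8) < 23 / 20 :=
    (Real.exp_bound_div_one_sub_of_interval' (by norm_num) (by norm_num)).trans_le (by norm_num)
  set r : ℝ := Real.exp (1 / 32) * (3 / 4) * 2 ^ (1 / 4 : ℝ) with hr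
  have pow_four_lt : r ^ 4 < 3 / 4 :=
    calc r ^ 4 = Real.exp (1 / 8) * (3 / 4) ^ 4 * 2 := by
          rw [hr, mul_pow, mul_pow, ← Real.exp_nat_mul, ← Real.rpow_mul_natCast two_pos.le]
          norm_num
      _ < 3 / 4 := by linarith
  have r_le_one : r ≤ 1 := (pow_le_one_iff_of_nonneg (by positivity) four_ne_zero).1 (by linarith)
  calc Real.exp (b / 32) * ((3 / 2) ^ b * 2 ^ (1 / 4 * (b : ℝ)))
      = r ^ b * 2 ^ b := by
        rw [hr, mul_pow, mul_pow, ← Real.exp_nat_mul, Real.rpow_mul_natCast two_pos.le,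
          show (3 / 2 : ℝ) = 3 / 4 * 2 by norm_num, mul_pow]
        ring_nf
    _ ≤ r ^ 4 * 2 ^ b := by gcongr ?_ * _; exact pow_le_pow_of_le_one (by positivity) r_le_one hb
    _ < 3 / 4 * 2 ^ b := by gcongr

lemma le_of_curator_learner {b c M : ℕ} (hb : 4 ≤ b)
    (P : CuratorProtocol M ((Bits c × Bits b) × Bool) (Bits c × Bits b → Bool))
    (hP : P.IsPrivateLearner) : (b : ℝ) / 8 ≤ M := by
  by_contra! hM
  have : NeZero b := ⟨by lia⟩
  have exp_le : Real.exp (1 / 4 * M) ≤ Real.exp (b / 32) := Real.exp_le_exp.2 (by linarith)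
  refine (exp_mul_rpow_lt hb).not_ge ?_
  calc (3 / 4 : ℝ) * 2 ^ b = (1 - 1 / 4) * 2 ^ b := by norm_num
    _ ≤ Real.exp (1 / 4 * M) * ((3 / 2) ^ b * 2 ^ (1 / 4 * (b : ℝ))) :=
      curator_lower_bound P hP.1 hP.2
    _ ≤ Real.exp (b / 32) * ((3 / 2) ^ b * 2 ^ (1 / 4 * (b : ℝ))) := by gcongr

end Asymptotics

theorem mainTheorem1 :
    ∃ m n : ℕ → ℕ,
      -- the sizes of the hybrid model
      ((fun c => (m c : ℝ)) =Θ[atTop] fun c : ℕ => (c : ℝ)) ∧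
      ((fun c => (n c : ℝ)) =Θ[atTop] fun c : ℕ => (c : ℝ) ^ 6 * Real.logb 2 c) ∧
      -- a non-interactive learner in the hybrid model
      (∀ c : ℕ, 1 ≤ c →
        ∃ P : HybridProtocol (m c) (n c) ((Bits c × Bits (c ^ 2)) × Bool)
            (Bits c × Bits (c ^ 2) → Bool),
          P.NonInteractive ∧ P.IsPrivateLearner) ∧
      -- the number of rounds in the local model
      (∃ κ : ℝ, 0 < κ ∧ ∀ N : ℕ → ℕ,
        ((fun c => (N c : ℝ)) =o[atTop] fun c => (2 : ℝ) ^ localExponent (n c)) →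
        ∀ᶠ c in atTop,
          ∀ P : LocalProtocol (N c) ((Bits c × Bits (c ^ 2)) × Bool)
              (Bits c × Bits (c ^ 2) → Bool),
            P.IsPrivateLearner → (2 : ℝ) ^ (κ * localExponent (n c)) ≤ P.rounds) ∧
      -- the number of samples in the curator model
      (∃ κ : ℝ, 0 < κ ∧ ∀ᶠ c in atTop, ∀ M : ℕ,
        ∀ P : CuratorProtocol M ((Bits c × Bits (c ^ 2)) × Bool)
            (Bits c × Bits (c ^ 2) → Bool),
          P.IsPrivateLearner → κ * (m c : ℝ) ^ 2 ≤ M) := by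
  refine ⟨curatorSize, agentCount, isTheta_curatorSize, isTheta_agentCount, fun c hc => ?_,
    ⟨1, one_pos, fun N hN => ?_⟩, ⟨1 / 2 ^ 43, by positivity, ?_⟩⟩
  · have : NeZero (c ^ 2) := ⟨by positivity⟩
    exact ⟨hybridLearner (c ^ 2) c (curatorSize c) (agentCount c) 128 (1 / 4),
      hybridLearner_nonInteractive,
      hybridLearner_isPrivateLearner hc le_rfl (by rw [← pow_mul]; exact Nat.le_add_right _ _)⟩
  · filter_upwards [hN.bound one_pos, eventually_two_pow_localExponent_lt (· ^ 2)]
      with c N_le lt_of_learner P hP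
    rw [Real.norm_of_nonneg (by positivity), Real.norm_of_nonneg (by positivity), one_mul] at N_le
    exact absurd (lt_of_learner (N c) P hP) N_le.not_gt
  · filter_upwards [eventually_ge_atTop 2] with c hc M P hP
    calc 1 / 2 ^ 43 * (curatorSize c : ℝ) ^ 2 = ((c ^ 2 : ℕ) : ℝ) / 8 := by
          simp only [curatorSize, Nat.cast_mul, Nat.cast_pow, Nat.cast_ofNat]
          ring
      _ ≤ M := le_of_curator_learner (Nat.pow_le_pow_left hc 2) P hP
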